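/- Let $(M,d)$ be a compact Riemannian metric space, that is, a compact connected smooth Riemannian manifold (without boundary) equipped with its global geodesic distance $d$. Let $N\ge 1$ be an integer such that every finite subspace $F$ of $(M,d)$ is loosely embeddable into Euclidean space $\mathbb{R}^N$: there is a continuous map $g:F\to\mathbb{R}^N$ such that, for all $x,x',z,z'\in F$, $$|g(x)-g(x')|=|g(z)-g(z')|\iff d(x,x')=d(z,z').$$ Then $(M,d)$ is weakly loosely embeddable in $\mathbb{R}^N$, by a continuous map: there is a continuous injective map $f:M\to\mathbb{R}^N$ such that, for all $x,x',z,z'\in M$, $$d(x,x')=d(z,z')\implies |f(x)-f(x')|=|f(z)-f(z')|.$$ -/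

import Mathlib

open Bundle
open scoped Manifold ContDiff

/-- A map `f` between metric spaces is a *loosely isometric embedding* (a loose embedding) if it is
continuous and `dist x x' ↦ dist (f x) (f x')` is a well-defined one-to-one map on the set of
distances of the source: equal distances go to equal distances, unequal ones to unequal ones. -/
structure IsLooseEmbedding {X Y : Type*} [MetricSpace X] [MetricSpace Y] (f : X → Y) : Prop where
  continuous : Continuous f
  dist_eq_iff : ∀ x x' z z' : X, dist (f x) (f x') = dist (f z) (f z') ↔ dist x x' = dist z z'

/-- `X` is *loosely embeddable* in `Y` if there is a loose embedding `X → Y`. -/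
def LooselyEmbeddable (X Y : Type*) [MetricSpace X] [MetricSpace Y] : Prop :=
  ∃ f : X → Y, IsLooseEmbedding f

/-- A *weak loose embedding* is an injective map that sends equal distances to equal distances.
A metric space `X` is weakly loosely embeddable in `Y` if there is such a map `X → Y`. -/
structure IsWeakLooseEmbedding {X Y : Type*} [MetricSpace X] [MetricSpace Y] (f : X → Y) :
    Prop where
  injective : Function.Injective f
  dist_eq : ∀ x x' z z' : X, dist x x' = dist z z' → dist (f x) (f x') = dist (f z) (f z')

/-!
Write `g F` for a loose embedding of a finite subset `F` of `M` in `ℝ^N`. A map `P` from `M` to a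
Euclidean space with `|P x - P y| = Φ (d(x, y))` for some function `Φ` will be called admissible
(`PreservesEqDist`). The theorem asks for an injective continuous admissible map. Rescaled maps
`g F` have pointwise limits along an ultrafilter on the finite subsets, as soon as they are
bounded, and the limits are admissible; what may get lost is injectivity.

*Dimension at least two.* All isosceles triangles with small legs `r` and base `s ≤ 2 r` occur in
`M` (`exists_isosceles`; this is a topological fact about spheres centred at midpoints of
geodesics). The triangle inequality in `ℝ^N` then gives `Φ s ≤ 2 Φ r` for `s ≤ 2 r`
(`PreservesEqDist.dist_le_two_mul`). Consequently the maps `g F`, normalized at a fixed pair of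
points, are bounded, bounded admissible maps are continuous, and a nonconstant admissible map can
only identify points whose distance is the diameter `D` (`PreservesEqDist.dist_le_of_eq`). So the
limit is injective unless `Φ D = 0`.

In that case every point turns out to have an antipode, a point `σ x` such that
`d(x, z) + d(z, σ x) = D` for all `z` (`PreservesEqDist.exists_antipode`). The image under `P` of a
geodesic is a curve along which distances depend only on the difference of parameters. Such a curve
is `C^1` and is determined by `Φ` and any initial piece (`exists_hasDerivAt_of_dist_eq`,
`eqOn_of_dist_eq_of_eqOn`): an affine relation between its points persists under translation of the
parameter. Hence `Φ` is asymptotically linear at `0`; combined with `Φ (D - t) = Φ t` and the fact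
that geodesics of a Riemannian manifold almost extend (`exists_almost_reflection`), this shows that
distances to a farthest point cannot be slightly less than `D`, so that all points have a point at
distance `D`; and rigidity of the image curves shows that such a point is an antipode.

Given antipodes, the maps `x ↦ g F x - g F (σ x)`, normalized to take values in the unit sphere,
have an admissible limit `k` by polarization, and `k (σ x) = -k x ≠ k x` (`exists_odd_limit`). So
`k` does not identify points at distance `D`, and is injective.

*Dimension one.* Here geodesics do not branch, two points at distance `D` are joined by exactly two
geodesics, and these cover `M` (`exists_isGeodesic_union_eq_univ`). So `M` is isometric to a circle,
which embeds as a round circle in `ℝ^2`; and `N ≥ 2`, since four equally spaced points of the circle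
have no loose embedding in the line (`two_le_of_square`).
-/

open Set Filter Topology Manifold

/-! ### Geodesics -/

/-- `γ` restricted to `[0, L]` is an isometric embedding, i.e. a minimizing geodesic of length `L`
parametrized by arc length. Values outside `[0, L]` are irrelevant. -/
def IsGeodesic {M : Type*} [MetricSpace M] (γ : ℝ → M) (L : ℝ) : Prop :=
  ∀ s ∈ Icc 0 L, ∀ t ∈ Icc 0 L, dist (γ s) (γ t) = |s - t|

/-- Any two points are joined by a minimizing geodesic. -/
def IsGeodesicSpace (M : Type*) [MetricSpace M] : Prop :=
  ∀ x y : M, ∃ γ : ℝ → M, γ 0 = x ∧ γ (dist x y) = y ∧ IsGeodesic γ (dist x y)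

section Geodesic

variable {M : Type*} [MetricSpace M]

theorem IsGeodesic.continuousOn {γ : ℝ → M} {L : ℝ}
    (h : IsGeodesic γ L) : ContinuousOn γ (Icc 0 L) :=
  LipschitzOnWith.continuousOn (K := 1) <| LipschitzOnWith.of_dist_le_mul fun s hs t ht ↦ by
    rw [h s hs t ht, NNReal.coe_one, one_mul, Real.dist_eq]

theorem IsGeodesic.mono {γ : ℝ → M} {a b : ℝ} (h : IsGeodesic γ b) (hab : a ≤ b) : IsGeodesic γ a :=
  fun s hs t ht ↦ h s ⟨hs.1, hs.2.trans hab⟩ t ⟨ht.1, ht.2.trans hab⟩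

theorem IsGeodesic.dist_zero {γ : ℝ → M} {L t : ℝ} (h : IsGeodesic γ L) (ht : t ∈ Icc 0 L) :
    dist (γ 0) (γ t) = t := by
  rw [h 0 ⟨le_rfl, ht.1.trans ht.2⟩ t ht, zero_sub, abs_neg, abs_of_nonneg ht.1]

theorem IsGeodesic.dist_end {γ : ℝ → M} {L t : ℝ} (h : IsGeodesic γ L) (ht : t ∈ Icc 0 L) :
    dist (γ t) (γ L) = L - t := by
  rw [h t ht L ⟨ht.1.trans ht.2, le_rfl⟩, abs_of_nonpos (by linarith [ht.2]), neg_sub]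

theorem IsGeodesic.concat {γ β : ℝ → M} {a b : ℝ} (hγ : IsGeodesic γ a) (hβ : IsGeodesic β b)
    (hab : γ a = β 0) (hd : dist (γ 0) (β b) = a + b) :
    IsGeodesic (fun t ↦ if t ≤ a then γ t else β (t - a)) (a + b) := by
  have hmix : ∀ s ∈ Icc 0 a, ∀ t ∈ Icc 0 b, dist (γ s) (β t) = t + a - s := by
    intro s hs t ht
    have d1 := hγ.dist_end hs
    have d2 := hβ.dist_zero ht
    have d3 := hβ.dist_end ht
    have d4 := hγ.dist_zero hs
    have t1 := dist_triangle (γ s) (γ a) (β t)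
    have t2 := dist_triangle4 (γ 0) (γ s) (β t) (β b)
    rw [hab] at t1 d1
    linarith
  intro s hs t ht
  rcases le_or_gt s a with h1 | h1 <;> rcases le_or_gt t a with h2 | h2
  · simp only [h1, h2, if_true]
    exact hγ s ⟨hs.1, h1⟩ t ⟨ht.1, h2⟩
  · simp only [h1, not_le.2 h2, if_true, if_false]
    rw [hmix s ⟨hs.1, h1⟩ _ ⟨by linarith, by linarith [ht.2]⟩, abs_of_neg (by linarith)]
    ring
  · simp only [h2, not_le.2 h1, if_true, if_false]
    rw [dist_comm, hmix t ⟨ht.1, h2⟩ _ ⟨by linarith, by linarith [hs.2]⟩, abs_of_pos (by linarith)]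
    ring
  · simp only [not_le.2 h1, not_le.2 h2, if_false]
    rw [hβ _ ⟨by linarith, by linarith [hs.2]⟩ _ ⟨by linarith, by linarith [ht.2]⟩,
      sub_sub_sub_cancel_right]

theorem IsGeodesicSpace.exists_continuous (hM : IsGeodesicSpace M) (x y : M) :
    ∃ γ : ℝ → M, Continuous γ ∧ γ 0 = x ∧ γ (dist x y) = y ∧ IsGeodesic γ (dist x y) := by
  obtain ⟨γ, h0, h1, hγ⟩ := hM x y
  have hL : (0 : ℝ) ≤ dist x y := dist_nonneg
  refine ⟨IccExtend hL ((Icc 0 (dist x y)).domRestrict γ),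
    (continuousOn_iff_continuous_domRestrict.1 hγ.continuousOn).Icc_extend', ?_, ?_, ?_⟩
  · rw [IccExtend_of_mem hL _ (left_mem_Icc.2 hL)]; exact h0
  · rw [IccExtend_of_mem hL _ (right_mem_Icc.2 hL)]; exact h1
  · intro s hs t ht
    rw [IccExtend_of_mem hL _ hs, IccExtend_of_mem hL _ ht]
    exact hγ s hs t ht

theorem IsGeodesicSpace.exists_isGeodesic_through (hM : IsGeodesicSpace M) {x y z : M} {D : ℝ}
    (h : dist x z + dist z y = D) (hxy : dist x y = D) :
    ∃ γ : ℝ → M, γ 0 = x ∧ γ D = y ∧ IsGeodesic γ D ∧ γ (dist x z) = z := by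
  obtain ⟨α, hα0, hα1, hα⟩ := hM x z
  obtain ⟨β, hβ0, hβ1, hβ⟩ := hM z y
  subst h
  refine ⟨fun t ↦ if t ≤ dist x z then α t else β (t - dist x z), ?_, ?_,
    hα.concat hβ (hα1.trans hβ0.symm) (by rw [hα0, hβ1, hxy]), ?_⟩
  · simp only [dist_nonneg, if_true, hα0]
  · rcases eq_or_lt_of_le (dist_nonneg : 0 ≤ dist z y) with h | h
    · rw [← h, add_zero]
      simp only [le_refl, if_true, hα1]
      exact dist_eq_zero.1 h.symm
    · simp only [not_le.2 (lt_add_of_pos_right (dist x z) h), if_false, add_sub_cancel_left, hβ1]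
  · simp only [le_refl, if_true, hα1]

end Geodesic

/-- A compact space in which any two points are joined by almost shortest paths is geodesic: for
each `ε` one picks points at prescribed distances from `x` along an almost shortest path, and an
ultralimit of these choices as `ε → 0` is a geodesic. -/
theorem isGeodesicSpace_of_almost_shortest {M : Type*} [MetricSpace M] [CompactSpace M]
    (h : ∀ (x y : M) (ε : ℝ), 0 < ε → ∃ c : ℝ → M, c 0 = x ∧ c 1 = y ∧ ContinuousOn c (Icc 0 1) ∧
      ∀ a ∈ Icc (0 : ℝ) 1, ∀ b ∈ Icc (0 : ℝ) 1, a ≤ b →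
        dist x (c a) + dist (c a) (c b) + dist (c b) y ≤ dist x y + ε) :
    IsGeodesicSpace M := by
  intro x y
  have key : ∀ k : ℕ, ∃ γ : ℝ → M, ∀ t ∈ Icc 0 (dist x y), dist x (γ t) = t ∧
      dist (γ t) y ≤ dist x y - t + 1 / ((k : ℝ) + 1) ∧
      ∀ s ∈ Icc 0 (dist x y), dist (γ s) (γ t) ≤ |s - t| + 1 / ((k : ℝ) + 1) := by
    intro k
    have hε : (0 : ℝ) < 1 / ((k : ℝ) + 1) := by positivity
    set ε := 1 / ((k : ℝ) + 1)
    obtain ⟨c, c0, c1, hc, hcd⟩ := h x y ε hε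
    have ivt : ∀ t ∈ Icc 0 (dist x y), ∃ τ ∈ Icc (0 : ℝ) 1, dist x (c τ) = t := by
      intro t ht
      have := intermediate_value_Icc (f := fun τ ↦ dist x (c τ)) zero_le_one
        (continuous_const.dist continuous_id |>.comp_continuousOn hc)
      simp only [c0, c1, dist_self] at this
      exact this ht
    choose! τ hτ hτd using ivt
    refine ⟨fun t ↦ c (τ t), fun t ht ↦ ⟨hτd t ht, ?_, fun s hs ↦ ?_⟩⟩
    · have := hcd (τ t) (hτ t ht) (τ t) (hτ t ht) le_rfl
      rw [hτd t ht, dist_self] at this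
      linarith
    · have h1 := hτd t ht
      have h2 := hτd s hs
      have t1 := dist_triangle x (c (τ t)) y
      have t2 := dist_triangle x (c (τ s)) y
      rcases le_total (τ s) (τ t) with hst | hst
      · have := hcd _ (hτ s hs) _ (hτ t ht) hst
        have := neg_abs_le (s - t)
        linarith
      · have := hcd _ (hτ t ht) _ (hτ s hs) hst
        rw [dist_comm (c (τ t))] at this
        have := le_abs_self (s - t)
        linarith
  choose γ hγ using key
  have lim : ∀ t, ∃ p : M, Tendsto (fun k ↦ γ k t) (hyperfilter ℕ : Filter ℕ) (𝓝 p) := by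
    intro t
    obtain ⟨p, -, hp⟩ := isCompact_univ.ultrafilter_le_nhds
      ((hyperfilter ℕ).map fun k ↦ γ k t) (by simp)
    exact ⟨p, hp⟩
  choose g hg using lim
  have hε : Tendsto (fun k : ℕ ↦ 1 / ((k : ℝ) + 1)) (hyperfilter ℕ : Filter ℕ) (𝓝 0) :=
    tendsto_one_div_add_atTop_nhds_zero_nat.mono_left Nat.hyperfilter_le_atTop
  have g1 : ∀ t ∈ Icc 0 (dist x y), dist x (g t) = t := fun t ht ↦
    tendsto_nhds_unique (Tendsto.dist tendsto_const_nhds (hg t))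
      (tendsto_const_nhds.congr fun k ↦ ((hγ k t ht).1).symm)
  have g2 : ∀ t ∈ Icc 0 (dist x y), dist (g t) y ≤ dist x y - t := fun t ht ↦ by
    have := le_of_tendsto_of_tendsto' ((hg t).dist tendsto_const_nhds)
      (tendsto_const_nhds.add hε) fun k ↦ (hγ k t ht).2.1
    simpa using this
  have g3 : ∀ t ∈ Icc 0 (dist x y), ∀ s ∈ Icc 0 (dist x y), dist (g s) (g t) ≤ |s - t| :=
    fun t ht s hs ↦ by
      have := le_of_tendsto_of_tendsto' ((hg s).dist (hg t))
        (tendsto_const_nhds.add hε) fun k ↦ (hγ k t ht).2.2 s hs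
      simpa using this
  refine ⟨g, ?_, ?_, fun s hs t ht ↦ le_antisymm (g3 t ht s hs) ?_⟩
  · exact (dist_eq_zero.1 (g1 0 ⟨le_rfl, dist_nonneg⟩)).symm
  · have := g2 (dist x y) ⟨dist_nonneg, le_rfl⟩
    exact dist_le_zero.1 (by linarith)
  · have e1 := g1 s hs
    have e2 := g1 t ht
    have t1 := dist_triangle x (g s) (g t)
    have t2 := dist_triangle x (g t) (g s)
    rw [dist_comm (g t) (g s)] at t2
    exact abs_le.2 ⟨by linarith, by linarith⟩

/-- A path from `x` to `y` is at least as long as the polygon through any two of its points. -/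
theorem dist_add_dist_add_dist_le_pathELength {n : ℕ} {M : Type*} [MetricSpace M]
    [ChartedSpace (EuclideanSpace ℝ (Fin n)) M]
    [RiemannianBundle (fun x : M ↦ TangentSpace (𝓡 n) x)] [IsRiemannianManifold (𝓡 n) M]
    {x y : M} {c : ℝ → M} (c0 : c 0 = x) (c1 : c 1 = y)
    (hc : ContMDiffOn 𝓘(ℝ) (𝓡 n) 1 c (Icc 0 1)) {a b : ℝ} (ha : a ∈ Icc (0 : ℝ) 1)
    (hb : b ∈ Icc (0 : ℝ) 1) (hab : a ≤ b) :
    edist x (c a) + edist (c a) (c b) + edist (c b) y ≤ pathELength (𝓡 n) c 0 1 := by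
  rw [← pathELength_add (I := 𝓡 n) (γ := c) ha.1 ha.2,
    ← pathELength_add (I := 𝓡 n) (γ := c) hab hb.2, ← add_assoc]
  simp only [IsRiemannianManifold.out (I := 𝓡 n)]
  gcongr
  · exact riemannianEDist_le_pathELength (hc.mono (Icc_subset_Icc le_rfl ha.2)) c0 rfl ha.1
  · exact riemannianEDist_le_pathELength (hc.mono (Icc_subset_Icc ha.1 hb.2)) rfl rfl hab
  · exact riemannianEDist_le_pathELength (hc.mono (Icc_subset_Icc hb.1 le_rfl)) rfl c1 hb.2

theorem isGeodesicSpace_of_isRiemannianManifold (n : ℕ) (M : Type*) [MetricSpace M] [CompactSpace M]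
    [ChartedSpace (EuclideanSpace ℝ (Fin n)) M]
    [RiemannianBundle (fun x : M ↦ TangentSpace (𝓡 n) x)] [IsRiemannianManifold (𝓡 n) M] :
    IsGeodesicSpace M := by
  refine isGeodesicSpace_of_almost_shortest fun x y ε hε ↦ ?_
  have hlt : riemannianEDist (𝓡 n) x y < ENNReal.ofReal (dist x y + ε) := by
    rw [← IsRiemannianManifold.out (I := 𝓡 n), edist_dist]
    exact (ENNReal.ofReal_lt_ofReal_iff (by positivity)).2 (by linarith)
  obtain ⟨c, c0, c1, hc, hlen⟩ := exists_lt_of_riemannianEDist_lt hlt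
  refine ⟨c, c0, c1, hc.continuousOn, fun a ha b hb hab ↦ ?_⟩
  have := (dist_add_dist_add_dist_le_pathELength c0 c1 hc ha hb hab).trans hlen.le
  rw [edist_dist, edist_dist, edist_dist, ← ENNReal.ofReal_add dist_nonneg dist_nonneg,
    ← ENNReal.ofReal_add (by positivity) dist_nonneg] at this
  exact (ENNReal.ofReal_le_ofReal_iff (by positivity)).1 this

/-! ### Riemannian charts are almost isometric at small scales -/

section Riemannian

variable {n : ℕ} {M : Type*} [MetricSpace M]
  [ChartedSpace (EuclideanSpace ℝ (Fin n)) M] [IsManifold (𝓡 n) ∞ M]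
  [RiemannianBundle (fun x : M ↦ TangentSpace (𝓡 n) x)]

/-- The norm of the tangent space at `x`, read on the model space through the preferred
trivialization of the tangent bundle at `x`. -/
noncomputable def tangentSeminorm (x : M) : Seminorm ℝ (EuclideanSpace ℝ (Fin n)) :=
  (normSeminorm ℝ (TangentSpace (𝓡 n) x)).comp
    ((trivializationAt (EuclideanSpace ℝ (Fin n)) (fun x : M ↦ TangentSpace (𝓡 n) x) x).symmL
      ℝ x).toLinearMap

/-- The linear functional on the model space given by the Riemannian inner product with `w`. -/
noncomputable def tangentFunctional (x : M) (w : TangentSpace (𝓡 n) x) :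
    EuclideanSpace ℝ (Fin n) →L[ℝ] ℝ :=
  (innerSL ℝ w).comp
    ((trivializationAt (EuclideanSpace ℝ (Fin n)) (fun x : M ↦ TangentSpace (𝓡 n) x) x).symmL ℝ x)

/-- Where the preferred trivialization at `x₀` distorts the Riemannian norm at most by a factor `r`,
the increment along a path of the coordinate dual to `w` is at most `r ‖w‖` times the length. -/
theorem abs_tangentFunctional_sub_le {x₀ : M} {r : ℝ} {γ : ℝ → M}
    (hγ : ContMDiffOn 𝓘(ℝ) (𝓡 n) 1 γ (Icc 0 1))
    (hs : ∀ t ∈ Icc (0 : ℝ) 1, γ t ∈ (chartAt (EuclideanSpace ℝ (Fin n)) x₀).source)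
    (hr : ∀ t ∈ Icc (0 : ℝ) 1,
      ‖((trivializationAt (EuclideanSpace ℝ (Fin n)) (fun x : M ↦ TangentSpace (𝓡 n) x) x₀).symmL
        ℝ x₀) ∘L ((trivializationAt (EuclideanSpace ℝ (Fin n))
          (fun x : M ↦ TangentSpace (𝓡 n) x) x₀).continuousLinearMapAt ℝ (γ t))‖ ≤ r)
    (w : TangentSpace (𝓡 n) x₀) :
    ‖tangentFunctional x₀ w (extChartAt (𝓡 n) x₀ (γ 1)) -
      tangentFunctional x₀ w (extChartAt (𝓡 n) x₀ (γ 0))‖ₑ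
      ≤ ENNReal.ofReal (‖w‖ * r) * pathELength (𝓡 n) γ 0 1 := by
  set F : ℝ → ℝ := fun t ↦ tangentFunctional x₀ w (extChartAt (𝓡 n) x₀ (γ t)) with hF
  have hder : ∀ t ∈ Icc (0 : ℝ) 1, HasDerivWithinAt F
      (tangentFunctional x₀ w (((trivializationAt (EuclideanSpace ℝ (Fin n))
          (fun x : M ↦ TangentSpace (𝓡 n) x) x₀).continuousLinearMapAt ℝ (γ t))
          (mfderivWithin 𝓘(ℝ) (𝓡 n) γ (Icc 0 1) t (1 : ℝ)))) (Icc 0 1) t := by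
    intro t ht
    have h1 : HasMFDerivWithinAt 𝓘(ℝ) (𝓡 n) γ (Icc 0 1) t
        (mfderivWithin 𝓘(ℝ) (𝓡 n) γ (Icc 0 1) t) :=
      ((hγ.mdifferentiableOn one_ne_zero) t ht).hasMFDerivWithinAt
    have h2 := (mdifferentiableAt_extChartAt (I := 𝓡 n) (hs t ht)).hasMFDerivAt
    rw [← TangentBundle.continuousLinearMapAt_trivializationAt (hs t ht)] at h2
    have h3 : HasMFDerivAt 𝓘(ℝ, EuclideanSpace ℝ (Fin n)) 𝓘(ℝ) (tangentFunctional x₀ w)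
      (extChartAt (𝓡 n) x₀ (γ t)) (tangentFunctional x₀ w) :=
      (tangentFunctional x₀ w).hasMFDerivAt
    have h4 := (h3.comp (γ t) h2).comp_hasMFDerivWithinAt t h1
    obtain ⟨f', hf', hf'1⟩ : ∃ f' : ℝ →L[ℝ] ℝ, HasFDerivWithinAt F f' (Icc 0 1) t ∧
        f' 1 = tangentFunctional x₀ w (((trivializationAt (EuclideanSpace ℝ (Fin n))
          (fun x : M ↦ TangentSpace (𝓡 n) x) x₀).continuousLinearMapAt ℝ (γ t))
          (mfderivWithin 𝓘(ℝ) (𝓡 n) γ (Icc 0 1) t (1 : ℝ))) :=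
      ⟨_, hasMFDerivWithinAt_iff_hasFDerivWithinAt.1 h4, rfl⟩
    rw [← hf'1]
    exact hf'.hasDerivWithinAt
  have hFC : ContDiffOn ℝ 1 F (Icc 0 1) := by
    rw [← contMDiffOn_iff_contDiffOn]
    have h1 := (contMDiffOn_extChartAt (I := 𝓡 n) (n := 1) (x := x₀)).comp hγ hs
    exact (tangentFunctional x₀ w).contMDiff.comp_contMDiffOn h1
  have h0 := enorm_sub_le_lintegral_derivWithin_Icc_of_contDiffOn_Icc hFC zero_le_one
  refine h0.trans ?_
  rw [pathELength_eq_lintegral_mfderivWithin_Icc,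
    ← MeasureTheory.lintegral_const_mul' _ _ ENNReal.ofReal_ne_top]
  refine MeasureTheory.setLIntegral_mono' measurableSet_Icc fun t ht ↦ ?_
  rw [(hder t ht).derivWithin (uniqueDiffOn_Icc zero_lt_one t ht)]
  set v := mfderivWithin 𝓘(ℝ) (𝓡 n) γ (Icc 0 1) t (1 : ℝ)
  have h5 : |tangentFunctional x₀ w (((trivializationAt (EuclideanSpace ℝ (Fin n))
          (fun x : M ↦ TangentSpace (𝓡 n) x) x₀).continuousLinearMapAt ℝ (γ t)) v)|
          ≤ ‖w‖ * r * ‖v‖ := by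
    refine (abs_real_inner_le_norm w _).trans ?_
    rw [mul_assoc]
    gcongr
    refine (ContinuousLinearMap.le_opNorm (((trivializationAt (EuclideanSpace ℝ (Fin n))
      (fun x : M ↦ TangentSpace (𝓡 n) x) x₀).symmL
        ℝ x₀) ∘L ((trivializationAt (EuclideanSpace ℝ (Fin n))
          (fun x : M ↦ TangentSpace (𝓡 n) x) x₀).continuousLinearMapAt ℝ (γ t))) v).trans ?_
    gcongr
    exact hr t ht
  have hr0 : 0 ≤ r := (ContinuousLinearMap.opNorm_nonneg _).trans (hr t ht)
  rw [Real.enorm_eq_ofReal_abs, ← ofReal_norm, ← ENNReal.ofReal_mul (by positivity)]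
  exact ENNReal.ofReal_le_ofReal h5

/-- Where the preferred trivialization at `x₀` distorts the Riemannian norm at most by a factor `r`,
the length of a path that is a segment in the chart at `x₀` is at most `r` times its length for the
constant metric given by the norm at `x₀`. -/
theorem pathELength_segment_le {x₀ : M} {r : ℝ} {a b : EuclideanSpace ℝ (Fin n)}
    (hs : ∀ t ∈ Icc (0 : ℝ) 1, AffineMap.lineMap a b t ∈ (extChartAt (𝓡 n) x₀).target)
    (hr : ∀ t ∈ Icc (0 : ℝ) 1,
      ‖((trivializationAt (EuclideanSpace ℝ (Fin n)) (fun x : M ↦ TangentSpace (𝓡 n) x) x₀).symmL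
        ℝ ((extChartAt (𝓡 n) x₀).symm (AffineMap.lineMap a b t))) ∘L
        ((trivializationAt (EuclideanSpace ℝ (Fin n))
          (fun x : M ↦ TangentSpace (𝓡 n) x) x₀).continuousLinearMapAt ℝ x₀)‖ ≤ r) :
    pathELength (𝓡 n) (fun t : ℝ ↦ (extChartAt (𝓡 n) x₀).symm (AffineMap.lineMap a b t)) 0 1
      ≤ ENNReal.ofReal (r * tangentSeminorm x₀ (b - a)) := by
  rw [pathELength_eq_lintegral_mfderivWithin_Icc]
  set χ := extChartAt (𝓡 n) x₀ with hχ
  have hle : ∀ t ∈ Icc (0 : ℝ) 1,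
      ‖mfderivWithin 𝓘(ℝ) (𝓡 n) (fun t : ℝ ↦ χ.symm (AffineMap.lineMap a b t)) (Icc 0 1) t
        (1 : ℝ)‖ ≤ r * tangentSeminorm x₀ (b - a) := by
    intro t ht
    set y := χ.symm (AffineMap.lineMap a b t) with hy
    have hys : y ∈ (chartAt (EuclideanSpace ℝ (Fin n)) x₀).source := by
      have := χ.map_target (hs t ht)
      rwa [hχ, extChartAt_source] at this
    have hχy : χ y = AffineMap.lineMap a b t := χ.right_inv (hs t ht)
    have h1 : HasMFDerivWithinAt 𝓘(ℝ, EuclideanSpace ℝ (Fin n)) (𝓡 n) χ.symm (range (𝓡 n))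
        (AffineMap.lineMap a b t)
        (mfderivWithin 𝓘(ℝ, EuclideanSpace ℝ (Fin n)) (𝓡 n) χ.symm (range (𝓡 n))
          (AffineMap.lineMap a b t)) :=
      (mdifferentiableWithinAt_extChartAt_symm (hs t ht)).hasMFDerivWithinAt
    have h2 : HasMFDerivWithinAt 𝓘(ℝ) 𝓘(ℝ, EuclideanSpace ℝ (Fin n))
        (fun t : ℝ ↦ (AffineMap.lineMap a b t : EuclideanSpace ℝ (Fin n))) (Icc 0 1) t
        (ContinuousLinearMap.toSpanSingleton ℝ (b - a)) :=
      hasMFDerivWithinAt_iff_hasFDerivWithinAt.2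
        (AffineMap.hasDerivAt_lineMap (a := a) (b := b) (x := t)).hasFDerivAt.hasFDerivWithinAt
    have h3 := h1.comp t h2 fun s _ ↦ by simp
    have huniq : UniqueMDiffWithinAt 𝓘(ℝ) (Icc (0 : ℝ) 1) t :=
      uniqueMDiffWithinAt_iff_uniqueDiffWithinAt.2 (uniqueDiffOn_Icc zero_lt_one t ht)
    have h4 := h3.mfderivWithin huniq
    have h5 : mfderivWithin 𝓘(ℝ) (𝓡 n) (fun t : ℝ ↦ χ.symm (AffineMap.lineMap a b t)) (Icc 0 1) t
        (1 : ℝ) = (mfderivWithin 𝓘(ℝ, EuclideanSpace ℝ (Fin n)) (𝓡 n) χ.symm (range (𝓡 n))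
          (AffineMap.lineMap a b t)) (b - a) := by
      have h6 : (ContinuousLinearMap.toSpanSingleton ℝ (b - a)) (1 : ℝ) = b - a := by simp
      rw [← h6]
      exact congr($h4 (1 : ℝ))
    have h7 := TangentBundle.symmL_trivializationAt (I := 𝓡 n) hys
    rw [← hχ, hχy] at h7
    have h8 : ‖mfderivWithin 𝓘(ℝ) (𝓡 n) (fun t : ℝ ↦ χ.symm (AffineMap.lineMap a b t)) (Icc 0 1) t
        (1 : ℝ)‖ = ‖(trivializationAt (EuclideanSpace ℝ (Fin n))
          (fun x : M ↦ TangentSpace (𝓡 n) x) x₀).symmL ℝ y (b - a)‖ := by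
      rw [h5]
      exact congr(‖$h7.symm (b - a)‖)
    rw [h8]
    have hx₀ : x₀ ∈ (trivializationAt (EuclideanSpace ℝ (Fin n))
          (fun x : M ↦ TangentSpace (𝓡 n) x) x₀).baseSet :=
      FiberBundle.mem_baseSet_trivializationAt' x₀
    have h9 := (trivializationAt (EuclideanSpace ℝ (Fin n))
          (fun x : M ↦ TangentSpace (𝓡 n) x) x₀).continuousLinearMapAt_symmL (R := ℝ) hx₀ (b - a)
    set w := (trivializationAt (EuclideanSpace ℝ (Fin n))
          (fun x : M ↦ TangentSpace (𝓡 n) x) x₀).symmL ℝ x₀ (b - a) with hw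
    rw [← h9]
    refine (ContinuousLinearMap.le_opNorm (((trivializationAt (EuclideanSpace ℝ (Fin n))
      (fun x : M ↦ TangentSpace (𝓡 n) x) x₀).symmL ℝ y) ∘L ((trivializationAt
        (EuclideanSpace ℝ (Fin n)) (fun x : M ↦ TangentSpace (𝓡 n) x) x₀).continuousLinearMapAt
          ℝ x₀)) w).trans ?_
    have h10 : tangentSeminorm x₀ (b - a) = ‖w‖ := rfl
    rw [h9, h10]
    gcongr
    exact hr t ht
  rw [← one_mul (ENNReal.ofReal _)]
  calc _ ≤ ∫⁻ t in Icc (0 : ℝ) 1, ENNReal.ofReal (r * tangentSeminorm x₀ (b - a)) := by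
        refine MeasureTheory.setLIntegral_mono' measurableSet_Icc fun t ht ↦ ?_
        rw [← ofReal_norm]
        exact ENNReal.ofReal_le_ofReal (hle t ht)
    _ = _ := by simp

theorem isContinuousRiemannianBundle_tangentSpace (n : ℕ) (M : Type*) [MetricSpace M]
    [ChartedSpace (EuclideanSpace ℝ (Fin n)) M] [IsManifold (𝓡 n) ∞ M]
    [RiemannianBundle (fun x : M ↦ TangentSpace (𝓡 n) x)]
    [IsContMDiffRiemannianBundle (𝓡 n) ∞ (EuclideanSpace ℝ (Fin n))
      (fun x : M ↦ TangentSpace (𝓡 n) x)] :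
    IsContinuousRiemannianBundle (EuclideanSpace ℝ (Fin n))
      (fun x : M ↦ TangentSpace (𝓡 n) x) := by
  obtain ⟨g, hg, hg'⟩ := IsContMDiffRiemannianBundle.exists_contMDiff (IB := 𝓡 n) (n := ∞)
    (F := EuclideanSpace ℝ (Fin n)) (E := fun x : M ↦ TangentSpace (𝓡 n) x)
  exact ⟨g, hg.continuous, hg'⟩

variable [IsContMDiffRiemannianBundle (𝓡 n) ∞ (EuclideanSpace ℝ (Fin n))
    (fun x : M ↦ TangentSpace (𝓡 n) x)]
  [IsRiemannianManifold (𝓡 n) M]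

/-- The inverse of a chart is almost distance nonincreasing near its centre. -/
theorem exists_ball_dist_symm_extChartAt_le (x₀ : M) {r : ℝ} (hr : 1 < r) :
    ∃ ρ > 0, Metric.ball (extChartAt (𝓡 n) x₀ x₀) ρ ⊆ (extChartAt (𝓡 n) x₀).target ∧
      ∀ a ∈ Metric.ball (extChartAt (𝓡 n) x₀ x₀) ρ, ∀ b ∈ Metric.ball (extChartAt (𝓡 n) x₀ x₀) ρ,
        dist ((extChartAt (𝓡 n) x₀).symm a) ((extChartAt (𝓡 n) x₀).symm b)
          ≤ r * tangentSeminorm x₀ (b - a) := by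
  have := isContinuousRiemannianBundle_tangentSpace n M
  have h1 := eventually_norm_symmL_trivializationAt_comp_self_lt (EuclideanSpace ℝ (Fin n))
    (fun x : M ↦ TangentSpace (𝓡 n) x) x₀ hr
  have h2 : Tendsto (extChartAt (𝓡 n) x₀).symm (𝓝 (extChartAt (𝓡 n) x₀ x₀)) (𝓝 x₀) := by
    have := continuousAt_extChartAt_symm (I := 𝓡 n) x₀
    rwa [ContinuousAt, extChartAt_to_inv] at this
  obtain ⟨ρ, hρ, hsub⟩ := Metric.mem_nhds_iff.1
    (inter_mem (h2.eventually h1) (extChartAt_target_mem_nhds (I := 𝓡 n) x₀))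
  refine ⟨ρ, hρ, fun a ha ↦ (hsub ha).2, fun a ha b hb ↦ ?_⟩
  have hmem : ∀ t ∈ Icc (0 : ℝ) 1,
      AffineMap.lineMap a b t ∈ Metric.ball (extChartAt (𝓡 n) x₀ x₀) ρ := fun t ht ↦
    (convex_ball _ _).lineMap_mem ha hb ht
  have h3 := pathELength_segment_le (r := r) (fun t ht ↦ (hsub (hmem t ht)).2)
    fun t ht ↦ (hsub (hmem t ht)).1.le
  have hsm : ContMDiffOn 𝓘(ℝ) (𝓡 n) 1
      (fun t : ℝ ↦ (extChartAt (𝓡 n) x₀).symm (AffineMap.lineMap a b t)) (Icc 0 1) := by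
    refine (contMDiffOn_extChartAt_symm (I := 𝓡 n) (n := 1) x₀).comp ?_
      fun t ht ↦ (hsub (hmem t ht)).2
    apply ContMDiff.contMDiffOn
    rw [contMDiff_iff_contDiff]
    exact (ContinuousAffineMap.lineMap (R := ℝ) a b).contDiff
  have h4 := (riemannianEDist_le_pathELength hsm
    (by rw [AffineMap.lineMap_apply_zero]) (by rw [AffineMap.lineMap_apply_one])
    zero_le_one).trans h3
  rw [← IsRiemannianManifold.out (I := 𝓡 n), edist_dist] at h4
  exact (ENNReal.ofReal_le_ofReal_iff (by positivity)).1 h4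

/-- A chart is almost distance nonincreasing near its centre: the norm at `x₀` of the difference of
two points in the chart is attained by the coordinate dual to that difference, which is controlled
along almost shortest paths. -/
theorem exists_ball_tangentSeminorm_le (x₀ : M) {r : ℝ} (hr : 1 < r) :
    ∃ ρ > 0, Metric.ball x₀ ρ ⊆ (extChartAt (𝓡 n) x₀).source ∧
      ∀ a ∈ Metric.ball x₀ ρ, ∀ b ∈ Metric.ball x₀ ρ,
        tangentSeminorm x₀ (extChartAt (𝓡 n) x₀ b - extChartAt (𝓡 n) x₀ a) ≤ r * dist a b := by
  have := isContinuousRiemannianBundle_tangentSpace n M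
  have h1 := eventually_norm_symmL_trivializationAt_self_comp_lt (EuclideanSpace ℝ (Fin n))
    (fun x : M ↦ TangentSpace (𝓡 n) x) x₀ hr
  obtain ⟨ρ, hρ, hsub⟩ := Metric.mem_nhds_iff.1
    (inter_mem h1 (chart_source_mem_nhds (EuclideanSpace ℝ (Fin n)) x₀))
  refine ⟨ρ / 4, by positivity, fun a ha ↦ ?_, fun a ha b hb ↦ ?_⟩
  · rw [extChartAt_source]
    exact (hsub (Metric.ball_subset_ball (by linarith) ha)).2
  set v := extChartAt (𝓡 n) x₀ b - extChartAt (𝓡 n) x₀ a with hv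
  set w := (trivializationAt (EuclideanSpace ℝ (Fin n))
          (fun x : M ↦ TangentSpace (𝓡 n) x) x₀).symmL ℝ x₀ v with hw
  have hvw : tangentSeminorm x₀ v = ‖w‖ := rfl
  rw [Metric.mem_ball] at ha hb
  have hab : dist a b < ρ / 2 := by
    have := dist_triangle_right a b x₀
    linarith
  rw [hvw]
  rcases (norm_nonneg w).eq_or_lt with h0 | h0
  · rw [← h0]; positivity
  have key : ∀ δ : ℝ, 0 < δ → δ < ρ / 4 → ‖w‖ ≤ r * (dist a b + δ) := by
    intro δ hδ hδρ
    have hlt : riemannianEDist (𝓡 n) a b < ENNReal.ofReal (dist a b + δ) := by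
      rw [← IsRiemannianManifold.out (I := 𝓡 n), edist_dist]
      exact (ENNReal.ofReal_lt_ofReal_iff (by positivity)).2 (by linarith)
    obtain ⟨c, c0, c1, hc, hlen⟩ := exists_lt_of_riemannianEDist_lt hlt
    have hmem : ∀ t ∈ Icc (0 : ℝ) 1, c t ∈ Metric.ball x₀ ρ := by
      intro t ht
      have h3 := (riemannianEDist_le_pathELength (hc.mono (Icc_subset_Icc le_rfl ht.2)) c0 rfl
        ht.1).trans ((pathELength_mono le_rfl ht.2).trans hlen.le)
      rw [← IsRiemannianManifold.out (I := 𝓡 n), edist_dist,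
        ENNReal.ofReal_le_ofReal_iff (by positivity)] at h3
      have := dist_triangle_left (c t) x₀ a
      rw [Metric.mem_ball]
      linarith
    have h4 := abs_tangentFunctional_sub_le hc (fun t ht ↦ (hsub (hmem t ht)).2)
      (fun t ht ↦ (hsub (hmem t ht)).1.le) w
    rw [← map_sub, c0, c1, ← hv] at h4
    have h5 : tangentFunctional x₀ w v = ‖w‖ ^ 2 := real_inner_self_eq_norm_sq w
    have h6 := h4.trans (mul_le_mul_right hlen.le _)
    rw [h5, Real.enorm_eq_ofReal (by positivity), ← ENNReal.ofReal_mul (by positivity),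
      ENNReal.ofReal_le_ofReal_iff (by positivity)] at h6
    have h7 : ‖w‖ * ‖w‖ ≤ ‖w‖ * (r * (dist a b + δ)) := by nlinarith
    exact le_of_mul_le_mul_left h7 h0
  have hlim : Tendsto (fun δ : ℝ ↦ r * (dist a b + δ)) (𝓝[>] 0) (𝓝 (r * (dist a b + 0))) :=
    ((tendsto_const_nhds.add tendsto_id).const_mul r).mono_left nhdsWithin_le_nhds
  rw [add_zero] at hlim
  refine ge_of_tendsto hlim ?_
  filter_upwards [Ioo_mem_nhdsGT (show (0 : ℝ) < ρ / 4 by positivity)] with δ hδ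
  exact key δ hδ.1 hδ.2

/-- Geodesics of a compact Riemannian manifold can be extended approximately, uniformly at small
scales: reflecting `v` through `w` in a chart that is almost isometric gives a point almost at
distance `d(w, v)` from `w` and almost at distance `2 d(w, v)` from `v`. -/
theorem exists_almost_reflection (n : ℕ) (M : Type*) [MetricSpace M] [CompactSpace M]
    [ChartedSpace (EuclideanSpace ℝ (Fin n)) M] [IsManifold (𝓡 n) ∞ M]
    [RiemannianBundle (fun x : M ↦ TangentSpace (𝓡 n) x)]
    [IsContMDiffRiemannianBundle (𝓡 n) ∞ (EuclideanSpace ℝ (Fin n))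
      (fun x : M ↦ TangentSpace (𝓡 n) x)]
    [IsRiemannianManifold (𝓡 n) M] {r : ℝ} (hr : 1 < r) :
    ∃ η > 0, ∀ w v : M, dist w v < η → ∃ w' : M,
      dist w w' ≤ r ^ 2 * dist w v ∧ 2 * dist w v ≤ r ^ 2 * dist v w' := by
  have loc : ∀ x₀ : M, ∃ δ > 0, ∀ w ∈ Metric.ball x₀ δ, ∀ v ∈ Metric.ball x₀ δ, ∃ w' : M,
      dist w w' ≤ r ^ 2 * dist w v ∧ 2 * dist w v ≤ r ^ 2 * dist v w' := by
    intro x₀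
    obtain ⟨ρ₁, hρ₁, hs₁, hd₁⟩ := exists_ball_dist_symm_extChartAt_le (n := n) x₀ hr
    obtain ⟨ρ₂, hρ₂, hs₂, hd₂⟩ := exists_ball_tangentSeminorm_le (n := n) x₀ hr
    set χ := extChartAt (𝓡 n) x₀ with hχ
    -- the reflection `(w, v) ↦ 2 w - v` read in the chart is continuous at `(x₀, x₀)`
    have hc : Tendsto (fun p : M × M ↦ (2 : ℝ) • χ p.1 - χ p.2) (𝓝 x₀ ×ˢ 𝓝 x₀) (𝓝 (χ x₀)) := by
      have h1 : Tendsto χ (𝓝 x₀) (𝓝 (χ x₀)) := continuousAt_extChartAt x₀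
      have h2 := ((h1.comp tendsto_fst).const_smul (2 : ℝ)).sub (h1.comp (tendsto_snd (f := 𝓝 x₀)))
      have h3 : (2 : ℝ) • χ x₀ - χ x₀ = χ x₀ := by rw [two_smul, add_sub_cancel_right]
      rwa [h3] at h2
    have hc1 : Tendsto χ (𝓝 x₀) (𝓝 (χ x₀)) := continuousAt_extChartAt x₀
    have hsymm : Tendsto χ.symm (𝓝 (χ x₀)) (𝓝 x₀) := by
      have := continuousAt_extChartAt_symm (I := 𝓡 n) x₀
      rwa [ContinuousAt, extChartAt_to_inv] at this
    have hev : ∀ᶠ p in 𝓝 x₀ ×ˢ 𝓝 x₀, p.1 ∈ Metric.ball x₀ ρ₂ ∧ p.2 ∈ Metric.ball x₀ ρ₂ ∧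
        χ p.1 ∈ Metric.ball (χ x₀) ρ₁ ∧ χ p.2 ∈ Metric.ball (χ x₀) ρ₁ ∧
        (2 : ℝ) • χ p.1 - χ p.2 ∈ Metric.ball (χ x₀) ρ₁ ∧
        χ.symm ((2 : ℝ) • χ p.1 - χ p.2) ∈ Metric.ball x₀ ρ₂ := by
      filter_upwards [tendsto_fst.eventually (Metric.ball_mem_nhds x₀ hρ₂),
        tendsto_snd.eventually (Metric.ball_mem_nhds x₀ hρ₂),
        (hc1.comp tendsto_fst).eventually (Metric.ball_mem_nhds (χ x₀) hρ₁),
        (hc1.comp (tendsto_snd (f := 𝓝 x₀))).eventually (Metric.ball_mem_nhds (χ x₀) hρ₁),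
        hc.eventually (Metric.ball_mem_nhds (χ x₀) hρ₁),
        (hsymm.comp hc).eventually (Metric.ball_mem_nhds x₀ hρ₂)] with p h1 h2 h3 h6 h4 h5
      exact ⟨h1, h2, h3, h6, h4, h5⟩
    obtain ⟨U, hU, V, hV, hUV⟩ := eventually_prod_iff.1 hev
    obtain ⟨δ, hδ, hδ'⟩ := Metric.mem_nhds_iff.1 (inter_mem hU hV)
    refine ⟨δ, hδ, fun w hw v hv ↦ ⟨χ.symm ((2 : ℝ) • χ w - χ v), ?_⟩⟩
    obtain ⟨h1, h2, h3, h6, h4, h5⟩ := hUV (hδ' hw).1 (hδ' hv).2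
    simp only at h1 h2 h3 h4 h5 h6
    have e1 : χ.symm (χ w) = w := χ.left_inv (hs₂ h1)
    have e2 : χ (χ.symm ((2 : ℝ) • χ w - χ v)) = (2 : ℝ) • χ w - χ v := χ.right_inv (hs₁ h4)
    have e3 : (2 : ℝ) • χ w - χ v - χ w = χ w - χ v := by rw [two_smul]; abel
    have e4 : (2 : ℝ) • χ w - χ v - χ v = (2 : ℝ) • (χ w - χ v) := by
      rw [two_smul, two_smul]; abel
    have d1 := hd₁ _ h3 _ h4
    rw [e1, e3] at d1
    have d2 := hd₂ _ h2 _ h1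
    have d3 := hd₂ _ h2 _ h5
    rw [e2, e4, map_smul_eq_mul, Real.norm_eq_abs, abs_two] at d3
    have d4 := hd₁ _ h3 _ h6
    rw [e1, χ.left_inv (hs₂ h2), map_sub_rev] at d4
    rw [dist_comm v w] at d2
    constructor <;> nlinarith
  choose δ hδ hloc using loc
  obtain ⟨η, hη, hleb⟩ := lebesgue_number_lemma_of_metric (isCompact_univ (X := M))
    (c := fun x ↦ Metric.ball x (δ x)) (fun _ ↦ Metric.isOpen_ball)
    fun x _ ↦ mem_iUnion.2 ⟨x, Metric.mem_ball_self (hδ x)⟩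
  refine ⟨η, hη, fun w v hwv ↦ ?_⟩
  obtain ⟨x, hx⟩ := hleb w (mem_univ w)
  exact hloc x w (hx (Metric.mem_ball_self hη)) v (hx (by rwa [Metric.mem_ball']))

end Riemannian

/-! ### Isosceles triangles in dimension at least two -/

section Separation

/-- A circle-valued continuous map on a ball of a normed space has a continuous logarithm. -/
theorem exists_continuousOn_lift_circle {E : Type*} [NormedAddCommGroup E] [NormedSpace ℝ E]
    {p : E} {R : ℝ} (hR : 0 < R) {c : E → Circle} (hc : ContinuousOn c (Metric.ball p R)) :
    ∃ ψ : E → ℝ, ContinuousOn ψ (Metric.ball p R) ∧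
      ∀ v ∈ Metric.ball p R, Circle.exp (ψ v) = c v := by
  have hconv : Convex ℝ (Metric.ball p R) := convex_ball p R
  have : ContractibleSpace (Metric.ball p R) :=
    hconv.contractibleSpace ⟨p, Metric.mem_ball_self hR⟩
  have : LocallyPathConnectedSpace (Metric.ball p R) := Metric.isOpen_ball.locallyPathConnectedSpace
  let f : C(Metric.ball p R, Circle) := ⟨fun v ↦ c v, continuousOn_iff_continuous_domRestrict.1 hc⟩
  let a₀ : Metric.ball p R := ⟨p, Metric.mem_ball_self hR⟩
  obtain ⟨e₀, he₀⟩ := Circle.exp_surjective (f a₀)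
  obtain ⟨F, ⟨-, hF⟩, -⟩ :=
    Circle.isCoveringMap_exp.existsUnique_continuousMap_lifts f (a₀ := a₀) (e₀ := e₀) he₀
  classical
  refine ⟨fun v ↦ if hv : v ∈ Metric.ball p R then F ⟨v, hv⟩ else 0, ?_, fun v hv ↦ ?_⟩
  · rw [continuousOn_iff_continuous_domRestrict]
    convert F.continuous using 1
    ext v
    exact dif_pos v.2
  · simp only [hv, dif_pos]
    exact congr($hF ⟨v, hv⟩)

theorem IsPreconnected.eq_of_forall_exists_int {X : Type*} [TopologicalSpace X] {S : Set X}
    (hS : IsPreconnected S) {f : X → ℝ} (hf : ContinuousOn f S) (h : ∀ x ∈ S, ∃ k : ℤ, f x = k)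
    {a b : X} (ha : a ∈ S) (hb : b ∈ S) : f a = f b := by
  have aux : ∀ a ∈ S, ∀ b ∈ S, ¬ f a < f b := by
    intro a ha b hb hab
    obtain ⟨k, hk⟩ := h a ha
    obtain ⟨l, hl⟩ := h b hb
    rw [hk, hl] at hab
    have hkl : k + 1 ≤ l := by exact_mod_cast hab
    have hkl' : (k : ℝ) + 1 ≤ l := by exact_mod_cast hkl
    obtain ⟨c, hc, hfc⟩ := hS.intermediate_value ha hb hf
      (show (k : ℝ) + 1 / 2 ∈ Icc (f a) (f b) by rw [hk, hl]; constructor <;> linarith)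
    obtain ⟨m, hm⟩ := h c hc
    rw [hm] at hfc
    have h1 : (k : ℝ) < m := by linarith
    have h2 : (m : ℝ) < k + 1 := by linarith
    have h1' : k < m := by exact_mod_cast h1
    have h2' : m < k + 1 := by exact_mod_cast h2
    omega
  exact le_antisymm (not_lt.1 (aux b hb a ha)) (not_lt.1 (aux a ha b hb))

/-- Annuli in dimension at least two are connected. -/
theorem isPreconnected_setOf_dist_mem {n : ℕ} (hn : 2 ≤ n) (p : EuclideanSpace ℝ (Fin n))
    {T : Set ℝ} (hT : IsPreconnected T) (hT0 : ∀ t ∈ T, 0 < t) :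
    IsPreconnected {v | dist v p ∈ T} := by
  have hrank : 1 < Module.rank ℝ (EuclideanSpace ℝ (Fin n)) := by
    rw [rank_eq_card_basis (EuclideanSpace.basisFun (Fin n) ℝ).toBasis]
    simpa using by exact_mod_cast hn
  have h2 : IsPreconnected (Metric.sphere (0 : EuclideanSpace ℝ (Fin n)) 1 ×ˢ T) :=
    (isPreconnected_sphere hrank 0 1).prod hT
  convert h2.image (fun q ↦ q.2 • q.1 + p) (by fun_prop) using 1
  ext v
  simp only [mem_ofPred_eq, mem_image, mem_prod, mem_sphere_iff_norm, sub_zero, Prod.exists]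
  constructor
  · intro h3
    have hpos : 0 < dist v p := hT0 _ h3
    refine ⟨(dist v p)⁻¹ • (v - p), dist v p, ⟨?_, h3⟩, ?_⟩
    · rw [norm_smul, norm_inv, ← dist_eq_norm, Real.norm_eq_abs, abs_of_pos hpos,
        inv_mul_cancel₀ hpos.ne']
    · rw [smul_smul, mul_inv_cancel₀ hpos.ne', one_smul, sub_add_cancel]
  · rintro ⟨u, t, ⟨hu, ht⟩, rfl⟩
    have : dist (t • u + p) p = t := by
      rw [dist_eq_norm, add_sub_cancel_right, norm_smul, hu, mul_one, Real.norm_eq_abs,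
        abs_of_pos (hT0 t ht)]
    rwa [this]

/-- In a manifold of dimension at least two, small metric spheres centred at the midpoint of a
geodesic have a connected component containing two antipodal points. Hence all isosceles triangles
with small legs `r` and base `s ≤ 2 r` occur.

If the antipodal points lay in different pieces `A`, `B` of a clopen partition of the sphere, take
`u` equal to `0` on `A` and to `1` on `B`; the circle-valued map equal to `exp (iπu)` inside the
sphere and `exp (-iπu)` outside lifts to a real function on a chart ball, whose increment between
the two points is `π` along the inside diameter and `-π` along a path outside the sphere. -/
theorem exists_isosceles {n : ℕ} (hn : 2 ≤ n) {M : Type*} [MetricSpace M] [CompactSpace M]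
    [ChartedSpace (EuclideanSpace ℝ (Fin n)) M] [Nontrivial M] (hM : IsGeodesicSpace M) :
    ∃ r₁ > 0, ∀ r, 0 < r → r ≤ r₁ → ∀ s, 0 ≤ s → s ≤ 2 * r →
      ∃ x y z : M, dist x y = r ∧ dist x z = r ∧ dist y z = s := by
  obtain ⟨a, b, hab⟩ := exists_pair_ne M
  obtain ⟨γ, -, -, hγ⟩ := hM a b
  have hL : 0 < dist a b := dist_pos.2 hab
  set L := dist a b
  set c : ℝ → M := fun t ↦ γ (L / 2 + t) with hc
  have hcd : ∀ s ∈ Icc (-(L / 2)) (L / 2), ∀ t ∈ Icc (-(L / 2)) (L / 2),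
      dist (c s) (c t) = |s - t| := by
    intro s hs t ht
    rw [hc]
    simp only
    rw [hγ _ ⟨by linarith [hs.1], by linarith [hs.2]⟩ _ ⟨by linarith [ht.1], by linarith [ht.2]⟩]
    congr 1; ring
  have hcc : ContinuousOn c (Icc (-(L / 2)) (L / 2)) :=
    LipschitzOnWith.continuousOn (K := 1) <| LipschitzOnWith.of_dist_le_mul fun s hs t ht ↦ by
      rw [hcd s hs t ht, NNReal.coe_one, one_mul, Real.dist_eq]
  set x := c 0 with hx
  have hxd : ∀ t ∈ Icc (-(L / 2)) (L / 2), dist x (c t) = |t| := by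
    intro t ht
    rw [hx, hcd 0 ⟨by linarith, by linarith⟩ t ht, zero_sub, abs_neg]
  set φ := chartAt (EuclideanSpace ℝ (Fin n)) x with hφ
  have hxs : x ∈ φ.source := mem_chart_source _ x
  obtain ⟨R, hR, hRt⟩ := Metric.mem_nhds_iff.1 (φ.open_target.mem_nhds (φ.map_source hxs))
  have hφx : ContinuousAt φ x := φ.continuousAt hxs
  obtain ⟨τ', hτ', hW⟩ := Metric.mem_nhds_iff.1 (inter_mem (φ.open_source.mem_nhds hxs)
    (hφx.preimage_mem_nhds (Metric.ball_mem_nhds (φ x) hR)))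
  set τ := min (τ' / 2) (L / 2) with hτ
  have hτ0 : 0 < τ := lt_min (by linarith) (by linarith)
  have hτL : τ ≤ L / 2 := min_le_right _ _
  have hττ' : τ < τ' := (min_le_left _ _).trans_lt (by linarith)
  have hcW : ∀ t ∈ Icc (-τ) τ, c t ∈ φ.source ∩ φ ⁻¹' Metric.ball (φ x) R := by
    intro t ht
    apply hW
    rw [Metric.mem_ball', hxd t ⟨by linarith [ht.1], by linarith [ht.2]⟩]
    exact (abs_le.2 ht).trans_lt hττ'
  have hne : ∀ t ∈ Icc (-τ) τ, t ≠ 0 → 0 < dist (φ (c t)) (φ x) := by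
    intro t ht ht0
    rw [dist_pos]
    intro h
    have h1 := φ.injOn (hcW t ht).1 hxs h
    have h2 := hxd t ⟨by linarith [ht.1], by linarith [ht.2]⟩
    rw [h1, dist_self] at h2
    exact ht0 (abs_eq_zero.1 h2.symm)
  have hτm : τ ∈ Icc (-τ) τ := ⟨by linarith, le_rfl⟩
  have hτm' : -τ ∈ Icc (-τ) τ := ⟨le_rfl, by linarith⟩
  set ρ := min (dist (φ (c (-τ))) (φ x)) (dist (φ (c τ)) (φ x)) with hρ
  have hρ0 : 0 < ρ := lt_min (hne _ hτm' (by linarith)) (hne _ hτm hτ0.ne')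
  obtain ⟨r₂, hr₂, hW₂⟩ := Metric.mem_nhds_iff.1
    (hφx.preimage_mem_nhds (Metric.ball_mem_nhds (φ x) hρ0))
  refine ⟨min (r₂ / 2) (τ / 2), lt_min (by linarith) (by linarith), fun r hr hrr s hs hsr ↦ ?_⟩
  have hr₂' : r < r₂ := (hrr.trans (min_le_left _ _)).trans_lt (by linarith)
  have hrτ : r < τ := (hrr.trans (min_le_right _ _)).trans_lt (by linarith)
  have hrm : r ∈ Icc (-τ) τ := ⟨by linarith, hrτ.le⟩
  have hrm' : -r ∈ Icc (-τ) τ := ⟨by linarith, by linarith⟩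
  set K := Metric.sphere x r with hK
  have hy₀ : c (-r) ∈ K := by
    rw [hK, Metric.mem_sphere', hxd _ ⟨by linarith, by linarith⟩, abs_neg, abs_of_pos hr]
  have hz₀ : c r ∈ K := by
    rw [hK, Metric.mem_sphere', hxd _ ⟨by linarith, by linarith⟩, abs_of_pos hr]
  have hKc : IsCompact K := Metric.isClosed_sphere.isCompact
  have : CompactSpace K := isCompact_iff_compactSpace.1 hKc
  by_cases hcomp : (⟨c r, hz₀⟩ : K) ∈ connectedComponent (⟨c (-r), hy₀⟩ : K)
  · have h1 := isPreconnected_connectedComponent.intermediate_value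
      (mem_connectedComponent (x := (⟨c (-r), hy₀⟩ : K))) hcomp
      (f := fun z : K ↦ dist (c (-r)) z) (by fun_prop)
    obtain ⟨z, -, hz⟩ := h1 (show s ∈ Icc _ _ by
      simp only [dist_self]
      rw [hcd _ ⟨by linarith, by linarith⟩ _ ⟨by linarith, by linarith⟩, abs_of_neg (by linarith)]
      exact ⟨hs, by linarith⟩)
    exact ⟨x, c (-r), z, Metric.mem_sphere'.1 hy₀, Metric.mem_sphere'.1 z.2, hz⟩
  exfalso
  rw [connectedComponent_eq_iInter_isClopen] at hcomp
  simp only [mem_iInter, Subtype.forall, not_forall] at hcomp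
  obtain ⟨Z, ⟨hZ, hyZ⟩, hzZ⟩ := hcomp
  set A : Set M := Subtype.val '' Z
  set B : Set M := Subtype.val '' Zᶜ
  have hA : IsClosed A := (hZ.1.isCompact.image continuous_subtype_val).isClosed
  have hB : IsClosed B := (hZ.2.isClosed_compl.isCompact.image continuous_subtype_val).isClosed
  have hAB : Disjoint A B :=
    (disjoint_image_iff Subtype.val_injective).2 disjoint_compl_right
  obtain ⟨u, huA, huB, -⟩ := exists_continuous_zero_one_of_isClosed hA hB hAB
  have hu : ∀ m, dist x m = r → u m = 0 ∨ u m = 1 := by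
    intro m hm
    by_cases h : (⟨m, Metric.mem_sphere'.2 hm⟩ : K) ∈ Z
    · exact Or.inl (huA ⟨_, h, rfl⟩)
    · exact Or.inr (huB ⟨_, h, rfl⟩)
  have huy : u (c (-r)) = 0 := huA ⟨_, hyZ, rfl⟩
  have huz : u (c r) = 1 := huB ⟨_, hzZ, rfl⟩
  have hagree : ∀ m, dist x m = r →
      Circle.exp (Real.pi * u m) = Circle.exp (-(Real.pi * u m)) := by
    intro m hm
    rcases hu m hm with h | h
    · simp [h]
    · rw [h, Circle.exp_eq_exp]
      exact ⟨1, by push_cast; ring⟩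
  set F : M → Circle := fun m ↦
    if dist x m ≤ r then Circle.exp (Real.pi * u m) else Circle.exp (-(Real.pi * u m)) with hF
  have hFc : Continuous F :=
    Continuous.if_le (by fun_prop) (by fun_prop) (by fun_prop) continuous_const hagree
  have hFin : ∀ m, dist x m ≤ r → F m = Circle.exp (Real.pi * u m) := fun m hm ↦ if_pos hm
  have hFout : ∀ m, r ≤ dist x m → F m = Circle.exp (-(Real.pi * u m)) := by
    intro m hm
    rcases hm.eq_or_lt with h | h
    · rw [← hagree m h.symm]; exact if_pos h.ge
    · exact if_neg (not_le.2 h)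
  obtain ⟨ψ, hψ, hψF⟩ := exists_continuousOn_lift_circle hR
    (hFc.comp_continuousOn (φ.continuousOn_symm.mono hRt))
  set W := φ.source ∩ φ ⁻¹' Metric.ball (φ x) R with hWdef
  have hψφ : ContinuousOn (fun m ↦ ψ (φ m)) W :=
    hψ.comp (φ.continuousOn.mono inter_subset_left) fun m hm ↦ hm.2
  have hψm : ∀ m ∈ W, Circle.exp (ψ (φ m)) = F m := by
    intro m hm
    rw [hψF _ hm.2, Function.comp_apply, φ.left_inv hm.1]
  -- along the inside diameter, `ψ - π u` is constant
  have hin : (ψ (φ (c (-r))) - Real.pi * u (c (-r))) / (2 * Real.pi)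
      = (ψ (φ (c r)) - Real.pi * u (c r)) / (2 * Real.pi) := by
    have hsub : Icc (-r) r ⊆ Icc (-τ) τ := Icc_subset_Icc (by linarith) hrτ.le
    have hpre : IsPreconnected (c '' Icc (-r) r) :=
      isPreconnected_Icc.image c (hcc.mono (Icc_subset_Icc (by linarith) (by linarith)))
    have hSW : c '' Icc (-r) r ⊆ W := image_subset_iff.2 fun t ht ↦ hcW t (hsub ht)
    refine hpre.eq_of_forall_exists_int
      (f := fun m ↦ (ψ (φ m) - Real.pi * u m) / (2 * Real.pi)) ?_ ?_
      ⟨-r, ⟨le_rfl, by linarith⟩, rfl⟩ ⟨r, ⟨by linarith, le_rfl⟩, rfl⟩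
    · exact ((hψφ.mono hSW).sub (by fun_prop)).div_const _
    · rintro m ⟨t, ht, rfl⟩
      have h1 := hψm _ (hSW ⟨t, ht, rfl⟩)
      rw [hFin _ (by rw [hxd t ⟨by linarith [ht.1], by linarith [ht.2]⟩]; exact abs_le.2 ht),
        Circle.exp_eq_exp] at h1
      obtain ⟨k, hk⟩ := h1
      refine ⟨k, ?_⟩
      rw [hk]
      field_simp
      ring
  -- along a path outside the sphere, `ψ + π u` is constant
  have hout : (ψ (φ (c (-r))) + Real.pi * u (c (-r))) / (2 * Real.pi)
      = (ψ (φ (c r)) + Real.pi * u (c r)) / (2 * Real.pi) := by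
    set An := {v | dist v (φ x) ∈ Ico ρ R} with hAn
    have hAnR : An ⊆ Metric.ball (φ x) R := fun v hv ↦ hv.2
    have hpre1 : IsPreconnected (c '' Icc (-τ) (-r)) :=
      isPreconnected_Icc.image c (hcc.mono (Icc_subset_Icc (by linarith) (by linarith)))
    have hpre2 : IsPreconnected (φ.symm '' An) :=
      (isPreconnected_setOf_dist_mem hn _ isPreconnected_Ico fun t ht ↦
        hρ0.trans_le ht.1).image _ (φ.continuousOn_symm.mono (hAnR.trans hRt))
    have hpre3 : IsPreconnected (c '' Icc r τ) :=
      isPreconnected_Icc.image c (hcc.mono (Icc_subset_Icc (by linarith) (by linarith)))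
    have hp1 : c (-τ) ∈ φ.symm '' An :=
      ⟨φ (c (-τ)), ⟨min_le_left _ _, (hcW _ hτm').2⟩, φ.left_inv (hcW _ hτm').1⟩
    have hp3 : c τ ∈ φ.symm '' An :=
      ⟨φ (c τ), ⟨min_le_right _ _, (hcW _ hτm).2⟩, φ.left_inv (hcW _ hτm).1⟩
    have hq1 : c (-τ) ∈ c '' Icc (-τ) (-r) := mem_image_of_mem c ⟨le_rfl, by linarith⟩
    have hq3 : c τ ∈ c '' Icc r τ := mem_image_of_mem c ⟨hrτ.le, le_rfl⟩
    have hq2 : c τ ∈ c '' Icc (-τ) (-r) ∪ φ.symm '' An := Or.inr hp3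
    have hpre := (hpre1.union' ⟨_, hq1, hp1⟩ hpre2).union' ⟨_, hq2, hq3⟩ hpre3
    have hprop : ∀ m ∈ c '' Icc (-τ) (-r) ∪ φ.symm '' An ∪ c '' Icc r τ, m ∈ W ∧ r ≤ dist x m := by
      rintro m ((⟨t, ht, rfl⟩ | ⟨v, hv, rfl⟩) | ⟨t, ht, rfl⟩)
      · refine ⟨hcW t ⟨ht.1, by linarith [ht.2]⟩, ?_⟩
        rw [hxd t ⟨by linarith [ht.1], by linarith [ht.2]⟩, abs_of_neg (by linarith [ht.2])]
        linarith [ht.2]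
      · have hvt := hRt (hAnR hv)
        refine ⟨⟨φ.map_target hvt, ?_⟩, ?_⟩
        · rw [mem_preimage, φ.right_inv hvt]; exact hAnR hv
        · by_contra! hlt
          have h1 := hW₂ (Metric.mem_ball'.2 (hlt.trans hr₂'))
          rw [mem_preimage, φ.right_inv hvt] at h1
          exact absurd hv.1 (not_le.2 h1)
      · refine ⟨hcW t ⟨by linarith [ht.1], ht.2⟩, ?_⟩
        rw [hxd t ⟨by linarith [ht.1], by linarith [ht.2]⟩]
        exact ht.1.trans (le_abs_self _)
    refine hpre.eq_of_forall_exists_int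
      (f := fun m ↦ (ψ (φ m) + Real.pi * u m) / (2 * Real.pi)) ?_ ?_
      (Or.inl (Or.inl ⟨-r, ⟨by linarith, le_rfl⟩, rfl⟩)) (Or.inr ⟨r, ⟨le_rfl, hrτ.le⟩, rfl⟩)
    · exact ((hψφ.mono fun m hm ↦ (hprop m hm).1).add (by fun_prop)).div_const _
    · intro m hm
      have h1 := hψm _ (hprop m hm).1
      rw [hFout _ (hprop m hm).2, Circle.exp_eq_exp] at h1
      obtain ⟨k, hk⟩ := h1
      refine ⟨k, ?_⟩
      rw [hk]
      field_simp
      ring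
  have hpi := Real.pi_pos
  rw [huy, huz, div_left_inj' (by positivity)] at hin hout
  linarith

end Separation

/-! ### Maps sending equal distances to equal distances -/

/-- A map sending equal distances to equal distances. -/
def PreservesEqDist {M E : Type*} [MetricSpace M] [MetricSpace E] (P : M → E) : Prop :=
  ∀ x x' z z' : M, dist x x' = dist z z' → dist (P x) (P x') = dist (P z) (P z')

section Weak

variable {M E : Type*} [MetricSpace M] [MetricSpace E] {P : M → E}

/-- The conclusion of `exists_isosceles` turned into an inequality: if all isosceles triangles with
legs `r ≤ r₁` and base `s ≤ 2 r` occur, small distances are distorted monotonically up to a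
factor two. -/
theorem PreservesEqDist.dist_le_two_mul (hP : PreservesEqDist P) {r₁ : ℝ}
    (hiso : ∀ r, 0 < r → r ≤ r₁ → ∀ s, 0 ≤ s → s ≤ 2 * r →
      ∃ x y z : M, dist x y = r ∧ dist x z = r ∧ dist y z = s)
    {x x' y y' : M} (hne : x ≠ x') (hx : dist x x' ≤ r₁) (hy : dist y y' ≤ 2 * dist x x') :
    dist (P y) (P y') ≤ 2 * dist (P x) (P x') := by
  obtain ⟨a, b, c, hab, hac, hbc⟩ := hiso _ (dist_pos.2 hne) hx _ dist_nonneg hy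
  rw [← hP _ _ _ _ hbc]
  have h1 := hP _ _ _ _ hab
  have h2 := hP _ _ _ _ hac
  have h3 := dist_triangle_left (P b) (P c) (P a)
  linarith

/-- If `P` were discontinuous, then by quasi-monotonicity all pairs of distinct nearby points would
have images at a distance bounded below, which is impossible for a bounded map. -/
theorem continuous_of_dist_le_two_mul [ProperSpace E] [Nontrivial M] (hM : IsGeodesicSpace M)
    (hb : Bornology.IsBounded (range P)) {r₁ : ℝ} (hr₁ : 0 < r₁)
    (hQ : ∀ x x' y y' : M, x ≠ x' → dist x x' ≤ r₁ → dist y y' ≤ 2 * dist x x' →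
      dist (P y) (P y') ≤ 2 * dist (P x) (P x')) : Continuous P := by
  rw [Metric.continuous_iff]
  by_contra! hcon
  obtain ⟨p, ε, hε, hcon⟩ := hcon
  have hsep : ∀ x x' : M, x ≠ x' → dist x x' ≤ r₁ → ε / 2 ≤ dist (P x) (P x') := by
    intro x x' hne hx
    obtain ⟨q, hq, hqε⟩ := hcon (dist x x') (dist_pos.2 hne)
    have := hQ x x' q p hne hx (by linarith [dist_nonneg (x := x) (y := x')])
    linarith
  obtain ⟨a, b, hab⟩ := exists_pair_ne M
  obtain ⟨γ, -, -, hγ⟩ := hM a b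
  have hL : 0 < dist a b := dist_pos.2 hab
  set m := min r₁ (dist a b)
  have hm : 0 < m := lt_min hr₁ hL
  have ht : ∀ k : ℕ, 0 < m / (k + 1) ∧ m / (k + 1) ≤ m := fun k ↦ by
    refine ⟨by positivity, div_le_self hm.le ?_⟩
    have : (0 : ℝ) ≤ k := k.cast_nonneg
    linarith
  have htI : ∀ k : ℕ, m / (k + 1) ∈ Icc 0 (dist a b) := fun k ↦
    ⟨(ht k).1.le, (ht k).2.trans (min_le_right _ _)⟩
  obtain ⟨y, -, φ, hφ, hlim⟩ := tendsto_subseq_of_bounded hb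
    (x := fun k : ℕ ↦ P (γ (m / (k + 1)))) fun k ↦ mem_range_self _
  obtain ⟨K, hK⟩ := Metric.cauchySeq_iff.1 hlim.cauchySeq (ε / 2) (by positivity)
  have h1 := hK K le_rfl (K + 1) (Nat.le_succ K)
  have hlt : φ K < φ (K + 1) := hφ (Nat.lt_succ_self K)
  have hd := hγ _ (htI (φ K)) _ (htI (φ (K + 1)))
  have hlt' : m / ((φ (K + 1) : ℝ) + 1) < m / ((φ K : ℝ) + 1) := by
    apply div_lt_div_of_pos_left hm (by positivity)
    have : (φ K : ℝ) < φ (K + 1) := by exact_mod_cast hlt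
    linarith
  rw [abs_of_pos (by linarith)] at hd
  have h2 := hsep (γ (m / (φ K + 1))) (γ (m / (φ (K + 1) + 1)))
    (dist_pos.1 (by rw [hd]; linarith))
    (by rw [hd]; linarith [(ht (φ K)).2, (ht (φ (K + 1))).1, min_le_left r₁ (dist a b)])
  exact absurd h1 (not_lt.2 h2)

/-- A pair of nearby points with the same image would make `P` locally constant. -/
theorem ne_of_dist_le [PreconnectedSpace M] {r₁ : ℝ}
    (hQ : ∀ x x' y y' : M, x ≠ x' → dist x x' ≤ r₁ → dist y y' ≤ 2 * dist x x' →
      dist (P y) (P y') ≤ 2 * dist (P x) (P x'))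
    (hne : ∃ a b, P a ≠ P b) {x y : M} (hxy : x ≠ y) (hd : dist x y ≤ r₁) : P x ≠ P y := by
  intro h
  have hloc : IsLocallyConstant P := by
    rw [IsLocallyConstant.iff_eventually_eq]
    intro z
    filter_upwards [Metric.ball_mem_nhds z (dist_pos.2 hxy)] with w hw
    have := hQ x y w z hxy hd (by linarith [Metric.mem_ball.1 hw, dist_nonneg (x := x) (y := y)])
    rw [h, dist_self, mul_zero] at this
    exact dist_le_zero.1 this
  obtain ⟨a, b, hab⟩ := hne
  exact hab (hloc.apply_eq_of_preconnectedSpace a b)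

/-- A nonconstant map `P` sending equal distances to equal distances can only identify points at
maximal distance. If `P x = P y` and `r = d(x, y)`, then for any `p` the sphere of radius `r` about
`p` is mapped to one point, hence is discrete, hence consists of local maxima of `d(p, ·)`. So the
closed ball of radius `r` about `p` is open, and is everything. -/
theorem PreservesEqDist.dist_le_of_eq {n : ℕ} (hn : 2 ≤ n)
    [ChartedSpace (EuclideanSpace ℝ (Fin n)) M] [PreconnectedSpace M] (hM : IsGeodesicSpace M)
    (hP : PreservesEqDist P) {r₁ : ℝ} (hr₁ : 0 < r₁)
    (hQ : ∀ x x' y y' : M, x ≠ x' → dist x x' ≤ r₁ → dist y y' ≤ 2 * dist x x' →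
      dist (P y) (P y') ≤ 2 * dist (P x) (P x'))
    (hne : ∃ a b, P a ≠ P b) {x y : M} (hxy : x ≠ y) (h : P x = P y) (p q : M) :
    dist p q ≤ dist x y := by
  set r := dist x y with hr
  have hr0 : 0 < r := dist_pos.2 hxy
  have heq : ∀ a b, dist a b = r → P a = P b := fun a b hab ↦ by
    have := hP _ _ _ _ hab
    rwa [h, dist_self, dist_eq_zero] at this
  have hclopen : IsClopen {z | dist p z ≤ r} := by
    refine ⟨isClosed_le (by fun_prop) continuous_const, isOpen_iff_mem_nhds.2 fun z hz ↦ ?_⟩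
    rcases (show dist p z ≤ r from hz).lt_or_eq with hlt | hzr
    · filter_upwards [(isOpen_lt (by fun_prop : Continuous fun z ↦ dist p z)
        continuous_const).mem_nhds hlt] with w hw using le_of_lt hw
    set φ := chartAt (EuclideanSpace ℝ (Fin n)) z
    have hzs : z ∈ φ.source := mem_chart_source _ z
    have hcont : ContinuousAt φ.symm (φ z) := φ.continuousAt_symm (φ.map_source hzs)
    have hnear : φ.symm ⁻¹' Metric.ball z r₁ ∈ 𝓝 (φ z) := by
      apply hcont.preimage_mem_nhds
      rw [φ.left_inv hzs]
      exact Metric.ball_mem_nhds z hr₁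
    obtain ⟨R, hR, hRt⟩ := Metric.mem_nhds_iff.1
      (inter_mem hnear (φ.open_target.mem_nhds (φ.map_source hzs)))
    set A : Set (EuclideanSpace ℝ (Fin n)) := {v | dist v (φ z) ∈ Ioo 0 R}
    have hA : IsPreconnected A :=
      isPreconnected_setOf_dist_mem hn _ isPreconnected_Ioo fun t ht ↦ ht.1
    have hAR : A ⊆ Metric.ball (φ z) R := fun v hv ↦ hv.2
    have hN : IsPreconnected (φ.symm '' A) :=
      hA.image _ (φ.continuousOn_symm.mono fun v hv ↦ (hRt (hAR hv)).2)
    have hNr : ∀ w ∈ φ.symm '' A, dist p w ≠ r := by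
      rintro _ ⟨v, hv, rfl⟩ hw
      have hne' : φ.symm v ≠ z := by
        intro h1
        have h2 := φ.right_inv (hRt (hAR hv)).2
        rw [h1] at h2
        exact hv.1.ne' (by rw [h2, dist_self])
      refine ne_of_dist_le hQ hne hne' (Metric.mem_ball.1 (hRt (hAR hv)).1).le ?_
      rw [← heq _ _ hw, heq _ _ hzr]
    have hWz : φ.source ∩ φ ⁻¹' Metric.ball (φ z) R ∈ 𝓝 z :=
      inter_mem (φ.open_source.mem_nhds hzs)
        ((φ.continuousAt hzs).preimage_mem_nhds (Metric.ball_mem_nhds _ hR))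
    -- the geodesic from `p` to `z` enters the punctured neighbourhood from inside the sphere
    obtain ⟨w₀, hw₀, hw₀r⟩ : ∃ w₀ ∈ φ.symm '' A, dist p w₀ < r := by
      obtain ⟨δ, hδ, hδW⟩ := Metric.mem_nhds_iff.1 hWz
      obtain ⟨γ, h0, h1, hγ⟩ := hM p z
      rw [hzr] at h1 hγ
      set t := min (δ / 2) r
      have ht : 0 < t := lt_min (by linarith) hr0
      have htr : t ≤ r := min_le_right _ _
      have htδ : t < δ := (min_le_left _ _).trans_lt (by linarith)
      have hd1 : dist p (γ (r - t)) = r - t := by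
        rw [← h0, hγ 0 ⟨le_rfl, hr0.le⟩ _ ⟨by linarith, by linarith⟩, abs_of_nonpos (by linarith)]
        ring
      have hd2 : dist (γ (r - t)) z = t := by
        rw [← h1, hγ _ ⟨by linarith, by linarith⟩ r ⟨hr0.le, le_rfl⟩, abs_of_nonpos (by linarith)]
        ring
      have hmem := hδW (Metric.mem_ball.2 (hd2.trans_lt htδ))
      refine ⟨γ (r - t), ⟨φ (γ (r - t)), ⟨dist_pos.2 fun h3 ↦ ?_, hmem.2⟩, φ.left_inv hmem.1⟩,
        by linarith⟩
      rw [φ.injOn hmem.1 hzs h3, dist_self] at hd2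
      linarith
    filter_upwards [hWz] with w hw
    by_cases hwz : w = z
    · rw [hwz, hzr]
    have hwN : w ∈ φ.symm '' A :=
      ⟨φ w, ⟨dist_pos.2 fun h3 ↦ hwz (φ.injOn hw.1 hzs h3), hw.2⟩, φ.left_inv hw.1⟩
    by_contra! hlt
    obtain ⟨c, hc, hcr⟩ := hN.intermediate_value hw₀ hwN (f := fun w ↦ dist p w) (by fun_prop)
      ⟨hw₀r.le, hlt.le⟩
    exact hNr c hc hcr
  have := hclopen.eq_univ ⟨p, by simp [hr0.le]⟩
  exact (this.symm ▸ mem_univ q : q ∈ {z | dist p z ≤ r})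

end Weak

/-! ### Curves with congruent pieces in a Euclidean space -/

section Helix

variable {E : Type*} [NormedAddCommGroup E] [InnerProductSpace ℝ E]

/-- Congruent families of points in a Euclidean space differ by a linear map. -/
theorem exists_linearMap_of_dist_eq {ι : Type*} (p q : ι → E) (i₀ : ι)
    (h : ∀ i j, dist (p i) (p j) = dist (q i) (q j)) :
    ∃ T : E →ₗ[ℝ] E, ∀ i, T (p i - p i₀) = q i - q i₀ := by
  have hinner : ∀ i j, inner ℝ (p i - p i₀) (p j - p i₀) = inner ℝ (q i - q i₀) (q j - q i₀) := by
    intro i j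
    have e : ∀ r : ι → E, inner ℝ (r i - r i₀) (r j - r i₀)
        = (dist (r i) (r i₀) ^ 2 + dist (r j) (r i₀) ^ 2 - dist (r i) (r j) ^ 2) / 2 := by
      intro r
      have h1 := norm_sub_sq_real (r i - r i₀) (r j - r i₀)
      rw [sub_sub_sub_cancel_right] at h1
      simp only [dist_eq_norm]
      linarith
    rw [e p, e q, h i i₀, h j i₀, h i j]
  set F : (ι →₀ ℝ) →ₗ[ℝ] E := Finsupp.linearCombination ℝ fun i ↦ p i - p i₀ with hF
  set G : (ι →₀ ℝ) →ₗ[ℝ] E := Finsupp.linearCombination ℝ fun i ↦ q i - q i₀ with hG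
  have hFG : ∀ c, inner ℝ (F c) (F c) = inner ℝ (G c) (G c) := by
    intro c
    simp only [hF, hG, Finsupp.linearCombination_apply, Finsupp.sum, sum_inner, inner_sum,
      real_inner_smul_left, real_inner_smul_right, hinner]
  obtain ⟨σ, hσ⟩ := F.rangeRestrict.exists_rightInverse_of_surjective F.range_rangeRestrict
  obtain ⟨T, hT⟩ := (G ∘ₗ σ).exists_extend
  refine ⟨T, fun i ↦ ?_⟩
  have h1 : F (Finsupp.single i 1) = p i - p i₀ := by simp [hF]
  have h2 : G (Finsupp.single i 1) = q i - q i₀ := by simp [hG]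
  set y := F.rangeRestrict (Finsupp.single i 1) with hy
  have h3 : T (p i - p i₀) = G (σ y) := by
    rw [← h1]
    exact congr($hT y)
  have h4 : F (σ y) = F (Finsupp.single i 1) := congrArg Subtype.val congr($hσ y)
  have h5 : F (σ y - Finsupp.single i 1) = 0 := by rw [map_sub, h4, sub_self]
  have h6 := hFG (σ y - Finsupp.single i 1)
  rw [h5, inner_zero_left, eq_comm, inner_self_eq_zero, map_sub, sub_eq_zero] at h6
  rw [h3, h6, h2]

variable [FiniteDimensional ℝ E]

/-- The value of a curve at `0` is a combination of the averages of the curve over the intervals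
`[0, b]`, `b` small, with total weight one: such combinations form a closed set. -/
theorem exists_finsupp_sum_integral_eq {g : ℝ → E} (hg : Continuous g) {η : ℝ} (hη : 0 < η) :
    ∃ c : Ioc 0 η →₀ ℝ, (c.sum fun b a ↦ a * (b : ℝ)) = 1 ∧
      (c.sum fun b a ↦ a • ∫ u in (0 : ℝ)..b, (g u - g 0)) = 0 := by
  set v : Ioc 0 η → E × ℝ := fun b ↦ (∫ u in (0 : ℝ)..b, (g u - g 0), (b : ℝ)) with hv
  have hclosed := Submodule.closed_of_finiteDimensional (Submodule.span ℝ (range v))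
  have hg0 : Continuous fun u ↦ g u - g 0 := hg.sub continuous_const
  have hder : HasDerivAt (fun b : ℝ ↦ ∫ u in (0 : ℝ)..b, (g u - g 0)) (g 0 - g 0) 0 :=
    intervalIntegral.integral_hasDerivAt_right
      (by simp) (hg0.stronglyMeasurableAtFilter _ _) hg0.continuousAt
  have hlim : Tendsto (fun b : ℝ ↦ (b⁻¹ • ∫ u in (0 : ℝ)..b, (g u - g 0), (1 : ℝ))) (𝓝[>] 0)
      (𝓝 ((0 : E), (1 : ℝ))) := by
    refine Tendsto.prodMk_nhds ?_ tendsto_const_nhds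
    have := hder.tendsto_slope_zero_right
    simpa using this
  have hmem : ((0 : E), (1 : ℝ)) ∈ Submodule.span ℝ (range v) := by
    refine hclosed.mem_of_tendsto hlim ?_
    filter_upwards [Ioc_mem_nhdsGT hη] with b hb
    have : (b⁻¹ • ∫ u in (0 : ℝ)..b, (g u - g 0), (1 : ℝ)) = b⁻¹ • v ⟨b, hb⟩ := by
      simp [hv, hb.1.ne']
    rw [this]
    exact Submodule.smul_mem _ _ (Submodule.subset_span ⟨_, rfl⟩)
  obtain ⟨c, hc⟩ := Finsupp.mem_span_range_iff_exists_finsupp.1 hmem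
  refine ⟨c, ?_, ?_⟩
  · have := congrArg Prod.snd hc
    simpa [hv, Finsupp.sum, Prod.snd_sum] using this
  · have := congrArg Prod.fst hc
    simpa [hv, Finsupp.sum, Prod.fst_sum] using this

/-- A continuous curve in a Euclidean space along which the distance of two points only depends on
the difference of their parameters is continuously differentiable: by rigidity, the formula
expressing its value at `0` through its integrals over small intervals holds at all times. -/
theorem exists_hasDerivAt_of_dist_eq {g : ℝ → E} (hg : Continuous g) {L : ℝ} (hL : 0 < L)
    {h : ℝ → ℝ} (hgh : ∀ s ∈ Icc 0 L, ∀ t ∈ Icc 0 L, dist (g s) (g t) = h |s - t|) :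
    ∃ k k' : ℝ → E, Continuous k' ∧ (∀ t, HasDerivAt k (k' t) t) ∧
      ∀ t ∈ Icc 0 (L / 2), k t = g t := by
  obtain ⟨c, hc1, hc0⟩ := exists_finsupp_sum_integral_eq hg (half_pos hL)
  refine ⟨fun t ↦ c.sum fun b a ↦ a • ∫ u in t..t + b, g u,
    fun t ↦ c.sum fun b a ↦ a • (g (t + b) - g t), ?_, fun t ↦ ?_, fun t ht ↦ ?_⟩
  · simp only [Finsupp.sum]
    fun_prop
  · simp only [Finsupp.sum]
    refine HasDerivAt.fun_sum fun b _ ↦ HasDerivAt.const_smul _ ?_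
    have h1 : ∀ x : ℝ, HasDerivAt (fun t ↦ ∫ u in (0 : ℝ)..t, g u) (g x) x := fun x ↦
      intervalIntegral.integral_hasDerivAt_right (hg.intervalIntegrable _ _)
        (hg.stronglyMeasurableAtFilter _ _) hg.continuousAt
    have h2 := ((h1 (t + b)).comp_add_const t b).sub (h1 t)
    refine h2.congr_of_eventuallyEq (Eventually.of_forall fun s ↦ ?_)
    simp only [Pi.sub_apply]
    rw [intervalIntegral.integral_interval_sub_left (hg.intervalIntegrable _ _)
      (hg.intervalIntegrable _ _)]
  · obtain ⟨T, hT⟩ := exists_linearMap_of_dist_eq (fun u : Icc 0 (L / 2) ↦ g u)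
      (fun u : Icc 0 (L / 2) ↦ g (t + u)) ⟨0, by constructor <;> linarith⟩ (by
        rintro ⟨u, hu⟩ ⟨w, hw⟩
        simp only
        rw [hgh u ⟨hu.1, by linarith [hu.2]⟩ w ⟨hw.1, by linarith [hw.2]⟩,
          hgh _ ⟨by linarith [hu.1, ht.1], by linarith [hu.2, ht.2]⟩ _
            ⟨by linarith [hw.1, ht.1], by linarith [hw.2, ht.2]⟩]
        congr 2; ring)
    set T' := LinearMap.toContinuousLinearMap T
    have hint : ∀ b : Ioc 0 (L / 2), ∫ u in t..t + b, g u
        = T' (∫ u in (0 : ℝ)..b, (g u - g 0)) + (b : ℝ) • g t := by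
      intro b
      have hg0 : Continuous fun u ↦ g u - g 0 := hg.sub continuous_const
      rw [← ContinuousLinearMap.intervalIntegral_comp_comm _ (hg0.intervalIntegrable _ _)]
      have h1 : ∫ u in (0 : ℝ)..b, T' (g u - g 0) = ∫ u in (0 : ℝ)..b, (g (t + u) - g t) := by
        refine intervalIntegral.integral_congr fun u hu ↦ ?_
        rw [uIcc_of_le b.2.1.le] at hu
        have := hT ⟨u, hu.1, hu.2.trans b.2.2⟩
        simp only [add_zero] at this
        exact this
      have hgt : Continuous fun u ↦ g (t + u) := by fun_prop
      rw [h1, intervalIntegral.integral_sub (hgt.intervalIntegrable _ _) (by simp),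
        intervalIntegral.integral_comp_add_left]
      simp
    simp only [hint, smul_add, smul_smul]
    rw [Finsupp.sum_add]
    have h2 : (c.sum fun b a ↦ a • T' (∫ u in (0 : ℝ)..b, (g u - g 0))) = 0 := by
      have := congrArg T' hc0
      simpa [Finsupp.sum, map_sum] using this
    have h3 : (c.sum fun b a ↦ (a * (b : ℝ)) • g t) = g t := by
      simp only [Finsupp.sum, ← Finset.sum_smul] at hc1 ⊢
      rw [hc1, one_smul]
    rw [h2, h3, zero_add]

/-- The distance function `h` of a nonconstant curve as in `exists_hasDerivAt_of_dist_eq` is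
asymptotically linear at `0`, and strictly increasing near `0`. -/
theorem exists_tendsto_div_and_strictMonoOn {g : ℝ → E} (hg : Continuous g) {L : ℝ} (hL : 0 < L)
    {h : ℝ → ℝ} (hgh : ∀ s ∈ Icc 0 L, ∀ t ∈ Icc 0 L, dist (g s) (g t) = h |s - t|)
    (hh : ∀ t, 0 < t → t < L → h t ≠ 0) :
    (∃ c > 0, Tendsto (fun t ↦ h t / t) (𝓝[>] 0) (𝓝 c)) ∧ ∃ δ > 0, StrictMonoOn h (Icc 0 δ) := by
  obtain ⟨k, k', hk', hk, hkg⟩ := exists_hasDerivAt_of_dist_eq hg hL hgh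
  have hslope : ∀ t, Tendsto (fun s ↦ s⁻¹ • (k (t + s) - k t)) (𝓝[>] 0) (𝓝 (k' t)) := fun t ↦
    (hk t).tendsto_slope_zero_right
  have hhk : ∀ t ∈ Icc 0 (L / 2), ∀ s ∈ Icc 0 (L / 2), t + s ≤ L / 2 →
      ‖k (t + s) - k t‖ = h s := by
    intro t ht s hs hts
    rw [hkg t ht, hkg (t + s) ⟨by linarith [ht.1, hs.1], hts⟩, ← dist_eq_norm,
      hgh _ ⟨by linarith [ht.1, hs.1], by linarith⟩ _ ⟨ht.1, by linarith [ht.2]⟩,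
      add_sub_cancel_left, abs_of_nonneg hs.1]
  have hlim : ∀ t, 0 ≤ t → t < L / 2 → Tendsto (fun s ↦ h s / s) (𝓝[>] 0) (𝓝 ‖k' t‖) := by
    intro t ht0 ht
    refine (hslope t).norm.congr' ?_
    filter_upwards [Ioo_mem_nhdsGT (show 0 < L / 2 - t by linarith)] with s hs
    rw [norm_smul, hhk t ⟨ht0, ht.le⟩ s ⟨hs.1.le, by linarith [hs.2]⟩ (by linarith [hs.2]),
      Real.norm_eq_abs, abs_of_pos (inv_pos.2 hs.1), inv_mul_eq_div]
  have hL2 : 0 < L / 2 := by linarith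
  have hc : 0 < ‖k' 0‖ := by
    by_contra hcon
    have h0 : ‖k' 0‖ = 0 := le_antisymm (not_lt.1 hcon) (norm_nonneg _)
    have hz : ∀ t ∈ Ico 0 (L / 2), k' t = 0 := fun t ht ↦ by
      have := tendsto_nhds_unique (hlim t ht.1 ht.2) (hlim 0 le_rfl hL2)
      rw [h0] at this
      exact norm_eq_zero.1 this
    have hconst := constant_of_has_deriv_right_zero (f := k) (a := 0) (b := L / 2)
      (fun t _ ↦ (hk t).continuousAt.continuousWithinAt)
      fun t ht ↦ (hz t ht ▸ hk t).hasDerivWithinAt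
    have h1 := hhk 0 ⟨le_rfl, hL2.le⟩ (L / 4) ⟨by linarith, by linarith⟩ (by linarith)
    rw [zero_add, hconst (L / 4) ⟨by linarith, by linarith⟩, sub_self, norm_zero] at h1
    exact hh (L / 4) (by linarith) (by linarith) h1.symm
  refine ⟨⟨_, hc, hlim 0 le_rfl hL2⟩, ?_⟩
  -- the derivative of `‖k t - k 0‖ ^ 2` is `2 ⟪k t - k 0, k' t⟫ ∼ 2 t ‖k' 0‖ ^ 2`
  have hinner : Tendsto (fun t ↦ inner ℝ (t⁻¹ • (k t - k 0)) (k' t)) (𝓝[>] 0) (𝓝 (‖k' 0‖ ^ 2)) := by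
    rw [← real_inner_self_eq_norm_sq]
    have := hslope 0
    simp only [zero_add] at this
    exact this.inner (hk'.continuousAt.tendsto.mono_left nhdsWithin_le_nhds)
  have hev := hinner.eventually (lt_mem_nhds (by positivity : 0 < ‖k' 0‖ ^ 2))
  obtain ⟨δ', hδ', hδ'2⟩ := mem_nhdsGT_iff_exists_Ioo_subset.1 hev
  refine ⟨min δ' (L / 2), lt_min hδ' hL2, ?_⟩
  have hH : StrictMonoOn (fun t ↦ ‖k t - k 0‖ ^ 2) (Icc 0 (min δ' (L / 2))) := by
    have hd : ∀ t, HasDerivAt (fun t ↦ ‖k t - k 0‖ ^ 2) (2 * inner ℝ (k t - k 0) (k' t)) t :=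
      fun t ↦ ((hk t).sub_const (k 0)).norm_sq
    refine strictMonoOn_of_deriv_pos (convex_Icc _ _)
      (fun t _ ↦ (hd t).continuousAt.continuousWithinAt) fun t ht ↦ ?_
    rw [interior_Icc] at ht
    rw [(hd t).deriv]
    have h1 : 0 < inner ℝ (t⁻¹ • (k t - k 0)) (k' t) :=
      hδ'2 ⟨ht.1, ht.2.trans_le (min_le_left _ _)⟩
    rw [real_inner_smul_left] at h1
    have := pos_of_mul_pos_right h1 (inv_pos.2 ht.1).le
    linarith
  intro s hs t ht hst
  have h1 := hH hs ht hst
  have e : ∀ t ∈ Icc 0 (min δ' (L / 2)), ‖k t - k 0‖ = h t := fun t ht ↦ by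
    have := hhk 0 ⟨le_rfl, hL2.le⟩ t ⟨ht.1, ht.2.trans (min_le_right _ _)⟩
      (by linarith [ht.2.trans (min_le_right _ _)])
    rwa [zero_add] at this
  simp only [e s hs, e t ht] at h1
  exact lt_of_pow_lt_pow_left₀ 2 (by rw [← e t ht]; positivity) h1

/-- Two curves in a Euclidean space along which the distance of two points is the same function of
the difference of their parameters coincide if they coincide on an initial interval. -/
theorem eqOn_of_dist_eq_of_eqOn {g₁ g₂ : ℝ → E} (hg : Continuous g₁) {L : ℝ} {h : ℝ → ℝ}
    (h₁ : ∀ s ∈ Icc 0 L, ∀ t ∈ Icc 0 L, dist (g₁ s) (g₁ t) = h |s - t|)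
    (h₂ : ∀ s ∈ Icc 0 L, ∀ t ∈ Icc 0 L, dist (g₂ s) (g₂ t) = h |s - t|)
    {s : ℝ} (hs : 0 < s) (heq : EqOn g₁ g₂ (Icc 0 s)) : EqOn g₁ g₂ (Icc 0 L) := by
  rcases le_or_gt L s with hsL | hsL
  · exact heq.mono (Icc_subset_Icc le_rfl hsL)
  -- `g₁ s` is an affine combination of finitely many values at earlier times
  set v : Ico 0 s → E × ℝ := fun u ↦ (g₁ u, 1) with hv
  have hclosed := Submodule.closed_of_finiteDimensional (Submodule.span ℝ (range v))
  have hmem : (g₁ s, (1 : ℝ)) ∈ Submodule.span ℝ (range v) := by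
    have hlim : Tendsto (fun u : ℝ ↦ (g₁ u, (1 : ℝ))) (𝓝[<] s) (𝓝 (g₁ s, (1 : ℝ))) :=
      (hg.continuousAt.tendsto.mono_left nhdsWithin_le_nhds).prodMk_nhds tendsto_const_nhds
    refine hclosed.mem_of_tendsto hlim ?_
    filter_upwards [Ico_mem_nhdsLT hs] with u hu using Submodule.subset_span ⟨⟨u, hu⟩, rfl⟩
  obtain ⟨c, hc⟩ := Finsupp.mem_span_range_iff_exists_finsupp.1 hmem
  have hc1 : ∑ u ∈ c.support, c u = 1 := by
    have := congrArg Prod.snd hc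
    simpa [hv, Finsupp.sum, Prod.snd_sum] using this
  have hc0 : ∑ u ∈ c.support, c u • (g₁ u - g₁ s) = 0 := by
    have := congrArg Prod.fst hc
    simp only [hv, Finsupp.sum, Prod.fst_sum, Prod.smul_fst] at this
    simp only [smul_sub, Finset.sum_sub_distrib, this, ← Finset.sum_smul, hc1, one_smul, sub_self]
  have htrans : ∀ g : ℝ → E, (∀ s ∈ Icc 0 L, ∀ t ∈ Icc 0 L, dist (g s) (g t) = h |s - t|) →
      ∀ τ, 0 ≤ τ → s + τ ≤ L → g (s + τ) = ∑ u ∈ c.support, c u • g (u + τ) := by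
    intro g hgd τ hτ hτL
    obtain ⟨T, hT⟩ := exists_linearMap_of_dist_eq (fun u : Icc 0 s ↦ g₁ u)
      (fun u : Icc 0 s ↦ g (u + τ)) ⟨s, hs.le, le_rfl⟩ (by
        rintro ⟨u, hu⟩ ⟨w, hw⟩
        simp only
        rw [h₁ u ⟨hu.1, by linarith [hu.2]⟩ w ⟨hw.1, by linarith [hw.2]⟩,
          hgd _ ⟨by linarith [hu.1], by linarith [hu.2]⟩ _
            ⟨by linarith [hw.1], by linarith [hw.2]⟩, add_sub_add_right_eq_sub])
    have h3 := congrArg T hc0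
    simp only [map_sum, map_smul, map_zero] at h3
    have h4 : ∀ u ∈ c.support, c u • T (g₁ u - g₁ s) = c u • g (u + τ) - c u • g (s + τ) := by
      intro u _
      rw [← smul_sub, ← hT ⟨u, u.2.1, u.2.2.le⟩]
    rw [Finset.sum_congr rfl h4, Finset.sum_sub_distrib, ← Finset.sum_smul, hc1, one_smul,
      sub_eq_zero] at h3
    exact h3.symm
  obtain ⟨m, hm, hmu⟩ : ∃ m > 0, ∀ u ∈ c.support, (u : ℝ) + m ≤ s := by
    have hev : ∀ᶠ m : ℝ in 𝓝[>] 0, ∀ u ∈ c.support, (u : ℝ) + m ≤ s := by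
      refine (Filter.eventually_all_finset _).2 fun u _ ↦ ?_
      filter_upwards [Ioc_mem_nhdsGT (sub_pos.2 u.2.2)] with m hm
      linarith [hm.2]
    obtain ⟨m, hmu, hm⟩ := (hev.and self_mem_nhdsWithin).exists
    exact ⟨m, hm, hmu⟩
  have key : ∀ j : ℕ, ∀ t, 0 ≤ t → t ≤ L → t ≤ s + j * m → g₁ t = g₂ t := by
    intro j
    induction j with
    | zero => exact fun t h0 _ hts ↦ heq ⟨h0, by simpa using hts⟩
    | succ j ih =>
      intro t h0 htL htj
      rcases le_or_gt t s with hts | hts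
      · exact heq ⟨h0, hts⟩
      have e : t = s + (t - s) := by ring
      rw [e, htrans g₁ h₁ (t - s) (by linarith) (by linarith),
        htrans g₂ h₂ (t - s) (by linarith) (by linarith)]
      refine Finset.sum_congr rfl fun u hu ↦ ?_
      have := hmu u hu
      push_cast at htj
      rw [ih _ (by linarith [u.2.1]) (by linarith) (by linarith)]
  intro t ht
  obtain ⟨j, hj⟩ := exists_nat_ge ((t - s) / m)
  rw [div_le_iff₀ hm] at hj
  exact key j t ht.1 ht.2 (by linarith)

end Helix

/-! ### Antipodes -/

section Antipode

variable {M : Type*} [MetricSpace M]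

variable {E : Type*} [NormedAddCommGroup E] [InnerProductSpace ℝ E]
  {P : M → E} {D : ℝ}

/-- The function `Φ` with `|P x - P y| = Φ (d(x, y))`, for a map `P` that identifies exactly the
pairs of points at maximal distance `D`. -/
theorem PreservesEqDist.exists_profile [FiniteDimensional ℝ E] (hM : IsGeodesicSpace M)
    (hP : PreservesEqDist P)
    (hc : Continuous P) (hD0 : 0 < D) (hD : ∀ p q : M, dist p q ≤ D) {p₀ q₀ : M}
    (hpq : dist p₀ q₀ = D) (hPpq : P p₀ = P q₀)
    (hinj : ∀ x y, P x = P y → x = y ∨ dist x y = D) :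
    ∃ Φ : ℝ → ℝ, Continuous Φ ∧ (∀ x y, dist (P x) (P y) = Φ (dist x y)) ∧
      (∀ t ∈ Icc 0 D, Φ (D - t) = Φ t) ∧ (∀ t, 0 < t → t < D → 0 < Φ t) ∧ Φ 0 = 0 ∧
      (∃ c > 0, Tendsto (fun t ↦ Φ t / t) (𝓝[>] 0) (𝓝 c)) ∧ ∃ δ > 0, StrictMonoOn Φ (Icc 0 δ) := by
  obtain ⟨γ, hγc, h0, h1, hγ⟩ := hM.exists_continuous p₀ q₀
  rw [hpq] at h1 hγ
  have hΦ : ∀ x y, dist (P x) (P y) = dist (P (γ 0)) (P (γ (dist x y))) := fun x y ↦ by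
    refine hP _ _ _ _ ?_
    rw [hγ _ ⟨le_rfl, hD0.le⟩ _ ⟨dist_nonneg, hD x y⟩, zero_sub, abs_neg, abs_of_nonneg dist_nonneg]
  have hgeo : ∀ s ∈ Icc 0 D, ∀ t ∈ Icc 0 D,
      dist (P (γ s)) (P (γ t)) = dist (P (γ 0)) (P (γ |s - t|)) := fun s hs t ht ↦ by
    rw [hΦ, hγ s hs t ht]
  have hpos : ∀ t, 0 < t → t < D → 0 < dist (P (γ 0)) (P (γ t)) := by
    intro t ht htD
    rw [dist_pos]
    intro h
    have hd : dist (γ 0) (γ t) = t := by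
      rw [hγ 0 ⟨le_rfl, hD0.le⟩ t ⟨ht.le, htD.le⟩, zero_sub, abs_neg, abs_of_pos ht]
    rcases hinj _ _ h with h | h
    · rw [h, dist_self] at hd; linarith
    · linarith
  have hex := exists_tendsto_div_and_strictMonoOn (hc.comp hγc) hD0
    (h := fun t ↦ dist (P (γ 0)) (P (γ t))) hgeo fun t h1 h2 ↦ (hpos t h1 h2).ne'
  refine ⟨fun t ↦ dist (P (γ 0)) (P (γ t)), by fun_prop, hΦ, fun t ht ↦ ?_, hpos, by simp, hex⟩
  simp only
  have := hgeo D ⟨hD0.le, le_rfl⟩ t ht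
  rw [abs_of_nonneg (by linarith [ht.2]), h1, ← hPpq, ← h0] at this
  exact this.symm

/-- Small values are only taken by `Φ` near the ends of `[0, D]`, where it is injective. -/
theorem exists_eq_or_eq_sub_of_eq {Φ : ℝ → ℝ} (hD0 : 0 < D) (hc : Continuous Φ)
    (hsymm : ∀ t ∈ Icc 0 D, Φ (D - t) = Φ t) (hpos : ∀ t, 0 < t → t < D → 0 < Φ t) (h0 : Φ 0 = 0)
    {δ : ℝ} (hδ : 0 < δ) (hmono : StrictMonoOn Φ (Icc 0 δ)) :
    ∃ δ' > 0, δ' < D / 2 ∧ ∀ s ∈ Icc 0 δ', ∀ t ∈ Icc 0 D, Φ t = Φ s → t = s ∨ t = D - s := by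
  set δ₁ := min δ (D / 3)
  have hδ₁ : 0 < δ₁ := lt_min hδ (by linarith)
  have hδ₁D : δ₁ ≤ D / 3 := min_le_right _ _
  obtain ⟨m, hmI, hm⟩ := isCompact_Icc.exists_isMinOn
    (nonempty_Icc.2 (show δ₁ ≤ D - δ₁ by linarith)) hc.continuousOn
  have hm0 : 0 < Φ m := hpos m (by linarith [hmI.1]) (by linarith [hmI.2])
  have hev : ∀ᶠ s in 𝓝 0, Φ s < Φ m := hc.continuousAt.eventually_lt_const (by rwa [h0])
  obtain ⟨δ₂, hδ₂, hball⟩ := Metric.eventually_nhds_iff.1 hev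
  refine ⟨min (δ₂ / 2) δ₁, lt_min (by linarith) hδ₁, (min_le_right _ _).trans_lt (by linarith),
    fun s hs t ht hst ↦ ?_⟩
  have hsδ : s ≤ δ₁ := hs.2.trans (min_le_right _ _)
  have hsI : s ∈ Icc 0 δ := ⟨hs.1, hsδ.trans (min_le_left _ _)⟩
  have hsm : Φ s < Φ m := hball (by
    rw [Real.dist_eq, sub_zero, abs_of_nonneg hs.1]
    linarith [hs.2.trans (min_le_left (δ₂ / 2) δ₁)])
  have htm : t < δ₁ ∨ D - δ₁ < t := by
    by_contra! hcon
    have := isMinOn_iff.1 hm t ⟨hcon.1, hcon.2⟩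
    linarith
  rcases htm with h | h
  · exact Or.inl (hmono.injOn ⟨ht.1, h.le.trans (min_le_left _ _)⟩ hsI hst)
  · right
    have : D - t = s := hmono.injOn
      ⟨by linarith [ht.2], (by linarith : D - t ≤ δ₁).trans (min_le_left _ _)⟩ hsI
      (by rw [hsymm t ht, hst])
    linarith

/-- If the distance from `z` to a farthest point `w` is close to the diameter `D`, it is equal to
`D`. Otherwise, with `e = D - d(z, w)`, let `v` precede `w` by `e` on a geodesic from `z` to `w`,
and let `w'` be an approximate reflection of `v` through `w`. As `Φ` is almost linear near `0` and
`Φ (D - t) = Φ t`, both `P z` and `P w'` are almost the reflection of `P v` through `P w`; so `P w'`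
is closer to `P z` than `Φ e`, which contradicts that `w'` is not farther from `z` than `w`. -/
theorem exists_dist_eq_of_farthest (hM : IsGeodesicSpace M) (hD0 : 0 < D)
    (hD : ∀ p q : M, dist p q ≤ D)
    (hX : ∀ r : ℝ, 1 < r → ∃ η > 0, ∀ w v : M, dist w v < η → ∃ w' : M,
      dist w w' ≤ r ^ 2 * dist w v ∧ 2 * dist w v ≤ r ^ 2 * dist v w')
    {Φ : ℝ → ℝ} (hΦ : ∀ x y, dist (P x) (P y) = Φ (dist x y))
    (hsymm : ∀ t ∈ Icc 0 D, Φ (D - t) = Φ t) (h0 : Φ 0 = 0)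
    {c : ℝ} (hc : 0 < c) (hlim : Tendsto (fun t ↦ Φ t / t) (𝓝[>] 0) (𝓝 c)) :
    ∃ η > 0, ∀ z w : M, (∀ w', dist z w' ≤ dist z w) → D - η < dist z w → dist z w = D := by
  have hev : ∀ᶠ t in 𝓝[>] 0, 0.999 * c < Φ t / t ∧ Φ t / t < 1.001 * c :=
    (hlim.eventually_const_lt (by linarith)).and (hlim.eventually_lt_const (by linarith))
  obtain ⟨t₀, ht₀, hbd⟩ := mem_nhdsGT_iff_exists_Ioo_subset.1 hev
  have ht₀' : 0 < t₀ := ht₀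
  have hbound : ∀ t, 0 ≤ t → t < t₀ → 0.999 * (c * t) ≤ Φ t ∧ Φ t ≤ 1.001 * (c * t) := by
    intro t ht htt
    rcases ht.eq_or_lt with rfl | ht
    · simp [h0]
    · obtain ⟨h1, h2⟩ := hbd ⟨ht, htt⟩
      rw [lt_div_iff₀ ht] at h1
      rw [div_lt_iff₀ ht] at h2
      constructor <;> linarith
  obtain ⟨η, hη, hrefl⟩ := hX 1.0005 (by norm_num)
  refine ⟨min η (min (t₀ / 4) (D / 4)), by positivity, fun z w hfar hzw ↦ ?_⟩
  by_contra hne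
  have hlt : dist z w < D := lt_of_le_of_ne (hD z w) hne
  obtain ⟨e, he⟩ : ∃ e, e = D - dist z w := ⟨_, rfl⟩
  have he0 : 0 < e := by linarith
  have heη : e < η := by linarith [min_le_left η (min (t₀ / 4) (D / 4))]
  have het : e < t₀ / 4 := by
    linarith [(min_le_right η (min (t₀ / 4) (D / 4))).trans (min_le_left _ _)]
  have heD : e < D / 4 := by
    linarith [(min_le_right η (min (t₀ / 4) (D / 4))).trans (min_le_right _ _)]
  have hzwd : dist z w = D - e := by linarith
  obtain ⟨γ, hγ0, hγ1, hγ⟩ := hM z w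
  rw [hzwd] at hγ1 hγ
  set v := γ (D - 2 * e) with hv
  have hzv : dist z v = D - 2 * e := by
    rw [← hγ0, hγ 0 ⟨le_rfl, by linarith⟩ _ ⟨by linarith, by linarith⟩, abs_of_neg (by linarith)]
    ring
  have hwv : dist w v = e := by
    rw [← hγ1, hγ _ ⟨by linarith, le_rfl⟩ _ ⟨by linarith, by linarith⟩, abs_of_pos (by linarith)]
    ring
  obtain ⟨w', hw'1, hw'2⟩ := hrefl w v (by rw [hwv]; exact heη)
  rw [hwv] at hw'1 hw'2
  norm_num at hw'1 hw'2
  have hx : 0 < c * e := mul_pos hc he0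
  -- all distances of images are known up to errors small enough to make the two bounds `0.3` on
  -- `‖a - u‖` and `‖b - u‖` below add up to less than the lower bound `0.999` on `‖a - b‖`
  have na : ‖P z - P w‖ ≤ 1.001 * (c * e) := by
    rw [← dist_eq_norm, hΦ, hzwd, hsymm e ⟨he0.le, by linarith⟩]
    exact (hbound e he0.le (by linarith)).2
  have nu : ‖P w - P v‖ ≤ 1.001 * (c * e) := by
    rw [← dist_eq_norm, hΦ, hwv]
    exact (hbound e he0.le (by linarith)).2
  have nau : 1.998 * (c * e) ≤ ‖(P z - P w) + (P w - P v)‖ := by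
    rw [sub_add_sub_cancel, ← dist_eq_norm, hΦ, hzv, hsymm _ ⟨by linarith, by linarith⟩]
    have := (hbound (2 * e) (by linarith) (by linarith)).1
    linarith
  have nb : ‖P w' - P w‖ ≤ 1.003 * (c * e) := by
    rw [← dist_eq_norm, dist_comm, hΦ]
    have h1 := (hbound (dist w w') dist_nonneg (by linarith)).2
    have h2 := mul_le_mul_of_nonneg_left hw'1 hc.le
    linarith
  have nbu : 1.995 * (c * e) ≤ ‖(P w' - P w) + (P w - P v)‖ := by
    rw [sub_add_sub_cancel, ← dist_eq_norm, dist_comm, hΦ]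
    have h3 := dist_triangle_left v w' w
    have h1 := (hbound (dist v w') dist_nonneg (by linarith)).1
    have h2 := mul_le_mul_of_nonneg_left hw'2 hc.le
    linarith
  have nab : 0.999 * (c * e) ≤ ‖(P z - P w) - (P w' - P w)‖ := by
    rw [sub_sub_sub_cancel_right, ← dist_eq_norm, hΦ]
    have h1 := hfar w'
    have h2 := dist_triangle z w' w
    rw [dist_comm w' w] at h2
    have h3 := hsymm (D - dist z w') ⟨by linarith [hD z w'],
      by linarith [dist_nonneg (x := z) (y := w')]⟩
    rw [sub_sub_cancel] at h3
    rw [h3]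
    have h4 := (hbound (D - dist z w') (by linarith) (by linarith)).1
    have h5 := mul_le_mul_of_nonneg_left (show e ≤ D - dist z w' by linarith) hc.le
    linarith
  set a := P z - P w
  set b := P w' - P w
  set u := P w - P v
  have p1 := parallelogram_law_with_norm ℝ a u
  have p2 := parallelogram_law_with_norm ℝ b u
  have q1 : ‖a - u‖ ≤ 0.3 * (c * e) := by
    refine abs_le_of_sq_le_sq' ?_ (by positivity) |>.2
    nlinarith [norm_nonneg a, norm_nonneg u]
  have q2 : ‖b - u‖ ≤ 0.3 * (c * e) := by
    refine abs_le_of_sq_le_sq' ?_ (by positivity) |>.2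
    nlinarith [norm_nonneg b, norm_nonneg u]
  have q3 : ‖a - b‖ ≤ ‖a - u‖ + ‖b - u‖ := by
    have := norm_sub_le (a - u) (b - u)
    rwa [sub_sub_sub_cancel_right] at this
  linarith

/-- The set of points that have a point at distance `D` is open and closed. -/
theorem exists_dist_eq_of_connected [CompactSpace M] [PreconnectedSpace M] {η : ℝ} (hη : 0 < η)
    (hfar : ∀ z w : M, (∀ w', dist z w' ≤ dist z w) → D - η < dist z w → dist z w = D)
    {p₀ q₀ : M} (hpq : dist p₀ q₀ = D) (x : M) : ∃ y, dist x y = D := by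
  have hclopen : IsClopen {x : M | ∃ y, dist x y = D} := by
    constructor
    · have h1 : IsClosed {p : M × M | dist p.1 p.2 = D} :=
        isClosed_eq (by fun_prop) continuous_const
      have h2 := (h1.isCompact.image continuous_fst).isClosed
      convert h2 using 1
      ext x
      simp
    · rw [Metric.isOpen_iff]
      rintro x ⟨y, hy⟩
      refine ⟨η, hη, fun z hz ↦ ?_⟩
      obtain ⟨w, -, hw⟩ := isCompact_univ.exists_isMaxOn ⟨x, mem_univ x⟩
        (by fun_prop : ContinuousOn (fun w : M ↦ dist z w) univ)
      have hw' : ∀ w', dist z w' ≤ dist z w := fun w' ↦ isMaxOn_iff.1 hw w' (mem_univ _)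
      refine ⟨w, hfar z w hw' ?_⟩
      have := dist_triangle x z y
      have := hw' y
      rw [Metric.mem_ball'] at hz
      linarith
  exact ((hclopen.eq_univ ⟨p₀, q₀, hpq⟩).symm ▸ mem_univ x : x ∈ {x : M | ∃ y, dist x y = D})

/-- If `d(x, y) = D`, all points lie on geodesics from `x` to `y`. Close to `x` this follows from
`Φ (d(z, y)) = Φ (d(z, x))`. In general, let `u` be close to `x` on a geodesic from `x` to `z`; a
geodesic through `x`, `u` and `y` has the same image under `P` as the one from `x` to `z`, by
rigidity, hence coincides with it, as `P` is locally injective. -/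
theorem dist_add_dist_eq_of_dist_eq [FiniteDimensional ℝ E] (hM : IsGeodesicSpace M)
    (hPc : Continuous P) (hD0 : 0 < D)
    (hD : ∀ p q : M, dist p q ≤ D)
    (hinj : ∀ x y, P x = P y → x = y ∨ dist x y = D) (hPD : ∀ x y, dist x y = D → P x = P y)
    {Φ : ℝ → ℝ} (hΦ : ∀ x y, dist (P x) (P y) = Φ (dist x y)) {δ : ℝ} (hδ : 0 < δ) (hδD : δ < D / 2)
    (hgap : ∀ s ∈ Icc 0 δ, ∀ t ∈ Icc 0 D, Φ t = Φ s → t = s ∨ t = D - s)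
    {x y : M} (hxy : dist x y = D) (z : M) : dist x z + dist z y = D := by
  have hsmall : ∀ u, dist x u ≤ δ → dist u y = D - dist x u := by
    intro u hu
    have h1 : Φ (dist u y) = Φ (dist x u) := by
      rw [← hΦ, ← hΦ, ← hPD x y hxy, dist_comm]
    rcases hgap _ ⟨dist_nonneg, hu⟩ _ ⟨dist_nonneg, hD u y⟩ h1 with h | h
    · have := dist_triangle x u y
      linarith
    · exact h
  rcases le_or_gt (dist x z) δ with hz | hz
  · rw [hsmall z hz]; ring
  obtain ⟨γ, hγc, hγ0, hγ1, hγ⟩ := hM.exists_continuous x z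
  set l := dist x z with hl
  have hlD : l ≤ D := hD x z
  set u := γ δ with hu
  have hxu : dist x u = δ := by
    rw [← hγ0, hγ 0 ⟨le_rfl, by linarith⟩ δ ⟨hδ.le, hz.le⟩, zero_sub, abs_neg, abs_of_pos hδ]
  have huy : dist u y = D - δ := by rw [hsmall u hxu.le, hxu]
  obtain ⟨β₁, hβ₁0, hβ₁1, hβ₁⟩ := hM u y
  rw [huy] at hβ₁1 hβ₁
  set β : ℝ → M := fun t ↦ if t ≤ δ then γ t else β₁ (t - δ)
  have hβ_le : ∀ t, t ≤ δ → β t = γ t := fun t ht ↦ if_pos ht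
  have hβD : β D = y := by
    rw [← hβ₁1]
    exact if_neg (by linarith)
  have hβ : IsGeodesic β D := by
    have := (hγ.mono hz.le).concat hβ₁ hβ₁0.symm (by rw [hγ0, hβ₁1, hxy]; ring)
    rwa [add_sub_cancel] at this
  have hPeq : EqOn (P ∘ γ) (P ∘ β) (Icc 0 l) := by
    refine eqOn_of_dist_eq_of_eqOn (hPc.comp hγc) (h := Φ) (fun s hs t ht ↦ ?_)
      (fun s hs t ht ↦ ?_) hδ fun t ht ↦ ?_
    · rw [Function.comp_apply, Function.comp_apply, hΦ, hγ s hs t ht]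
    · rw [Function.comp_apply, Function.comp_apply, hΦ, hβ s ⟨hs.1, hs.2.trans hlD⟩ t
        ⟨ht.1, ht.2.trans hlD⟩]
    · rw [Function.comp_apply, Function.comp_apply, hβ_le t ht.2]
  have hzβ : γ l = β l := by
    rcases hinj _ _ (hPeq ⟨dist_nonneg, le_rfl⟩) with h | h
    · exact h
    exfalso
    have hcont : ContinuousOn (fun t ↦ dist (γ t) (β t)) (Icc 0 l) := by
      have h1 := hγc.continuousOn (s := Icc 0 l)
      have h2 := hβ.continuousOn.mono (Icc_subset_Icc le_rfl hlD)
      exact continuous_dist.comp_continuousOn (h1.prodMk h2)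
    have hivt := intermediate_value_Icc (dist_nonneg : 0 ≤ l) hcont
    simp only [hβ_le 0 hδ.le, dist_self, h] at hivt
    obtain ⟨t, ht, htd⟩ := hivt ⟨by linarith, by linarith⟩ (a := D / 2)
    simp only at htd
    rcases hinj _ _ (hPeq ht) with h' | h'
    · rw [h', dist_self] at htd; linarith
    · linarith
  rw [← hγ1, hzβ, ← hβD, hβ l ⟨dist_nonneg, hlD⟩ D ⟨hD0.le, le_rfl⟩, abs_of_nonpos (by linarith)]
  ring

/-- If a continuous map sending equal distances to equal distances identifies exactly the pairs of
points at maximal distance `D`, then every point `x` has an antipode `σ x`, and all points lie on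
geodesics from `x` to `σ x`. -/
theorem PreservesEqDist.exists_antipode [FiniteDimensional ℝ E] [CompactSpace M]
    [PreconnectedSpace M]
    (hM : IsGeodesicSpace M) (hP : PreservesEqDist P)
    (hX : ∀ r : ℝ, 1 < r → ∃ η > 0, ∀ w v : M, dist w v < η → ∃ w' : M,
      dist w w' ≤ r ^ 2 * dist w v ∧ 2 * dist w v ≤ r ^ 2 * dist v w')
    (hPc : Continuous P) (hD0 : 0 < D) (hD : ∀ p q : M, dist p q ≤ D) {p₀ q₀ : M}
    (hpq : dist p₀ q₀ = D) (hPpq : P p₀ = P q₀)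
    (hinj : ∀ x y, P x = P y → x = y ∨ dist x y = D) :
    ∃ σ : M → M, ∀ x z, dist x z + dist z (σ x) = D := by
  obtain ⟨Φ, hΦc, hΦ, hsymm, hpos, h0, ⟨c, hc, hlim⟩, δ, hδ, hmono⟩ :=
    hP.exists_profile hM hPc hD0 hD hpq hPpq hinj
  obtain ⟨δ', hδ', hδ'D, hgap⟩ := exists_eq_or_eq_sub_of_eq hD0 hΦc hsymm hpos h0 hδ hmono
  obtain ⟨η, hη, hfar⟩ := exists_dist_eq_of_farthest hM hD0 hD hX hΦ hsymm h0 hc hlim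
  choose σ hσ using exists_dist_eq_of_connected hη hfar hpq
  have hPD : ∀ x y, dist x y = D → P x = P y := fun x y hxy ↦ by
    rw [← dist_eq_zero, hP x y p₀ q₀ (by rw [hxy, hpq]), hPpq, dist_self]
  exact ⟨σ, fun x z ↦
    dist_add_dist_eq_of_dist_eq hM hPc hD0 hD hinj hPD hΦ hδ' hδ'D hgap (hσ x) z⟩

end Antipode

/-! ### Ultralimits of loose embeddings of finite subsets -/

section UltraLimit

variable {M : Type*} [MetricSpace M]

/-- The values on `F` of a map into `E`, extended by `0`, send equal distances to equal distances
and different ones to different ones. -/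
def IsLooseOn {E : Type*} [MetricSpace E] (g : M → E) (F : Finset M) : Prop :=
  ∀ x ∈ F, ∀ x' ∈ F, ∀ z ∈ F, ∀ z' ∈ F,
    dist (g x) (g x') = dist (g z) (g z') ↔ dist x x' = dist z z'

theorem exists_isLooseOn {E : Type*} [MetricSpace E] [Inhabited E]
    (hfin : ∀ F : Set M, F.Finite → LooselyEmbeddable F E) (F : Finset M) :
    ∃ g : M → E, IsLooseOn g F := by
  classical
  obtain ⟨g, hg⟩ := hfin F F.finite_toSet
  refine ⟨fun x ↦ if hx : x ∈ F then g ⟨x, hx⟩ else default, fun x hx x' hx' z hz z' hz' ↦ ?_⟩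
  simp only [hx, hx', hz, hz', dif_pos]
  exact hg.dist_eq_iff ⟨x, hx⟩ ⟨x', hx'⟩ ⟨z, hz⟩ ⟨z', hz'⟩

theorem exists_tendsto_of_eventually_norm_le {ι X E : Type*} [NormedAddCommGroup E] [ProperSpace E]
    (U : Ultrafilter ι) {φ : ι → X → E} {C : X → ℝ}
    (h : ∀ x, ∀ᶠ i in U, ‖φ i x‖ ≤ C x) :
    ∃ f : X → E, ∀ x, Tendsto (fun i ↦ φ i x) U (𝓝 (f x)) := by
  have : ∀ x, ∃ p, Tendsto (fun i ↦ φ i x) U (𝓝 p) := fun x ↦ by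
    obtain ⟨p, -, hp⟩ := (isCompact_closedBall (0 : E) (C x)).ultrafilter_le_nhds
      (U.map fun i ↦ φ i x) (le_principal_iff.2 <| show ∀ᶠ i in U, φ i x ∈ _ from
        (h x).mono fun i hi ↦ mem_closedBall_zero_iff.2 hi)
    exact ⟨p, hp⟩
  choose f hf using this
  exact ⟨f, hf⟩

theorem eventually_mem_of_le_atTop {M : Type*} {U : Ultrafilter (Finset M)}
    (hU : (U : Filter (Finset M)) ≤ atTop) (x : M) : ∀ᶠ F in (U : Filter (Finset M)), x ∈ F := by
  refine hU ?_
  filter_upwards [eventually_ge_atTop ({x} : Finset M)] with F hF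
  exact Finset.singleton_subset_iff.1 hF

theorem preservesEqDist_of_tendsto {ι E : Type*} [MetricSpace E] {U : Ultrafilter ι}
    {φ : ι → M → E} {f : M → E} (hf : ∀ x, Tendsto (fun i ↦ φ i x) U (𝓝 (f x)))
    (h : ∀ x x' z z' : M, dist x x' = dist z z' →
      ∀ᶠ i in U, dist (φ i x) (φ i x') = dist (φ i z) (φ i z')) : PreservesEqDist f := by
  intro x x' z z' hd
  refine tendsto_nhds_unique ((hf x).dist (hf x')) (((hf z).dist (hf z')).congr' ?_)
  filter_upwards [h x x' z z' hd] with i hi using hi.symm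

variable {E : Type*} [NormedAddCommGroup E] [InnerProductSpace ℝ E] [FiniteDimensional ℝ E]

/-- An ultralimit, over the finite subsets of `M`, of loose embeddings normalized at one pair of
points at distance `r₁`. The normalized maps are bounded since any two points are joined by a chain
of steps of equal length at most `2 r₁`, whose number is bounded. -/
theorem exists_preservesEqDist_limit [CompactSpace M] (hM : IsGeodesicSpace M)
    {g : Finset M → M → E} (hg : ∀ F, IsLooseOn (g F) F) {r₁ : ℝ} (hr₁ : 0 < r₁)
    (hiso : ∀ s, 0 ≤ s → s ≤ 2 * r₁ →
      ∃ x y z : M, dist x y = r₁ ∧ dist x z = r₁ ∧ dist y z = s) :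
    ∃ f : M → E, PreservesEqDist f ∧ Bornology.IsBounded (range f) ∧ ∃ a b, f a ≠ f b := by
  obtain ⟨a, b, -, hab, -⟩ := hiso 0 le_rfl (by linarith)
  have hab0 : a ≠ b := dist_pos.1 (hab ▸ hr₁)
  obtain ⟨K, hK⟩ : ∃ K : ℕ, ∀ x y : M, dist x y ≤ K * r₁ := by
    obtain ⟨K, hK⟩ := exists_nat_ge (Metric.diam (univ : Set M) / r₁)
    rw [div_le_iff₀ hr₁] at hK
    exact ⟨K, fun x y ↦ (Metric.dist_le_diam_of_mem isCompact_univ.isBounded (mem_univ x)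
      (mem_univ y)).trans hK⟩
  have hK0 : 0 < (K : ℝ) := by
    have := hK a b
    rw [hab] at this
    by_contra! h
    nlinarith
  let U : Ultrafilter (Finset M) := Ultrafilter.of atTop
  have hU : (U : Filter (Finset M)) ≤ atTop := Ultrafilter.of_le atTop
  have hmem := eventually_mem_of_le_atTop hU
  have hchain : ∀ x, ∀ᶠ F in U, dist (g F a) (g F x) ≤ K * (2 * dist (g F a) (g F b)) := by
    intro x
    obtain ⟨γ, h0, h1, hγ⟩ := hM a x
    set s := dist a x / K with hs
    have hs0 : 0 ≤ s := by positivity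
    have hKs : K * s = dist a x := by rw [hs]; field_simp
    have hsr : s ≤ r₁ := by rw [hs, div_le_iff₀ hK0, mul_comm]; exact hK a x
    obtain ⟨X, Y, Z, hXY, hXZ, hYZ⟩ := hiso s hs0 (by linarith)
    have hev : ∀ᶠ F in (U : Filter (Finset M)), ∀ i ∈ Finset.range (K + 1), γ (i * s) ∈ F :=
      (Filter.eventually_all_finset _).2 fun i _ ↦ hmem (γ (i * s))
    filter_upwards [hmem a, hmem b, hmem X, hmem Y, hmem Z, hev] with F ha hb hX hY hZ hi
    have hstep : ∀ i ∈ Finset.range K,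
        dist (g F (γ (i * s))) (g F (γ ((i + 1 : ℕ) * s))) ≤ 2 * dist (g F a) (g F b) := by
      intro i hiK
      have hiK' := Finset.mem_range.1 hiK
      have hle : ((i + 1 : ℕ) : ℝ) * s ≤ dist a x := by
        rw [← hKs]
        exact mul_le_mul_of_nonneg_right (by exact_mod_cast hiK') hs0
      have hle' : (i : ℝ) * s ≤ dist a x := by push_cast at hle; linarith
      have hd : dist (γ (i * s)) (γ ((i + 1 : ℕ) * s)) = dist Y Z := by
        rw [hγ _ ⟨by positivity, hle'⟩ _ ⟨by positivity, hle⟩, hYZ]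
        push_cast
        rw [abs_of_nonpos (by linarith)]
        ring
      rw [(hg F _ (hi i (Finset.mem_range.2 (by omega))) _
        (hi (i + 1) (Finset.mem_range.2 (by omega))) Y hY Z hZ).2 hd]
      have e1 := (hg F X hX Y hY a ha b hb).2 (hXY.trans hab.symm)
      have e2 := (hg F X hX Z hZ a ha b hb).2 (hXZ.trans hab.symm)
      have := dist_triangle_left (g F Y) (g F Z) (g F X)
      linarith
    have hsum := dist_le_range_sum_dist (fun i : ℕ ↦ g F (γ (i * s))) K
    have hsum2 := Finset.sum_le_sum hstep
    rw [Finset.sum_const, Finset.card_range, nsmul_eq_mul] at hsum2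
    simp only [Nat.cast_zero, zero_mul, h0, hKs, h1] at hsum
    exact hsum.trans hsum2
  have hpos : ∀ F : Finset M, a ∈ F → b ∈ F → 0 < dist (g F a) (g F b) := by
    intro F ha hb
    refine dist_pos.2 fun h ↦ hab0 ?_
    have := (hg F a ha b hb a ha a ha).1 (by rw [h])
    rwa [dist_self, dist_eq_zero] at this
  let φ : Finset M → M → E := fun F x ↦ (dist (g F a) (g F b))⁻¹ • (g F x - g F a)
  have hφd : ∀ F x y, dist (φ F x) (φ F y) = (dist (g F a) (g F b))⁻¹ * dist (g F x) (g F y) := by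
    intro F x y
    rw [dist_smul₀, dist_sub_right, norm_inv, Real.norm_eq_abs, abs_of_nonneg dist_nonneg]
  have hφb : ∀ x, ∀ᶠ F in U, ‖φ F x‖ ≤ 2 * K := by
    intro x
    filter_upwards [hchain x, hmem a, hmem b] with F hF ha hb
    have h1 := hφd F a x
    simp only [φ, sub_self, smul_zero, dist_zero_left] at h1
    simp only [φ]
    rw [h1, inv_mul_le_iff₀ (hpos F ha hb)]
    linarith
  obtain ⟨f, hf⟩ := exists_tendsto_of_eventually_norm_le U hφb
  refine ⟨f, preservesEqDist_of_tendsto hf fun x x' z z' hd ↦ ?_, ?_, a, b, fun hfab ↦ ?_⟩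
  · filter_upwards [hmem x, hmem x', hmem z, hmem z'] with F hx hx' hz hz'
    rw [hφd, hφd, (hg F x hx x' hx' z hz z' hz').2 hd]
  · refine (Metric.isBounded_closedBall (x := (0 : E)) (r := 2 * K)).subset ?_
    rintro _ ⟨x, rfl⟩
    rw [mem_closedBall_zero_iff]
    exact le_of_tendsto (hf x).norm (hφb x)
  · have h1 : Tendsto (fun F ↦ dist (φ F a) (φ F b)) U (𝓝 (dist (f a) (f b))) := (hf a).dist (hf b)
    have h2 : Tendsto (fun F ↦ dist (φ F a) (φ F b)) U (𝓝 1) := by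
      refine tendsto_const_nhds.congr' ?_
      filter_upwards [hmem a, hmem b] with F ha hb
      rw [hφd, inv_mul_cancel₀ (hpos F ha hb).ne']
    have h3 := tendsto_nhds_unique h1 h2
    rw [hfab, dist_self] at h3
    exact zero_ne_one h3

/-- Given antipodes in `M`, an ultralimit of the maps `x ↦ g x - g (σ x)`, for `g` loose embeddings
of finite subsets, normalized to take values in the unit sphere. By polarization,
`|(g x - g (σ x)) - (g y - g (σ y))|` is determined by the distances between the points
`x, σ x, y, σ y`, and so by `d(x, y)`. -/
theorem exists_odd_limit {D : ℝ} (hD0 : 0 < D) {σ : M → M}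
    (hσ : ∀ x z, dist x z + dist z (σ x) = D) {g : Finset M → M → E}
    (hg : ∀ F, IsLooseOn (g F) F) [Nonempty M] :
    ∃ k : M → E, PreservesEqDist k ∧ (∀ x, ‖k x‖ = 1) ∧ ∀ x, k (σ x) = -k x := by
  have hσd : ∀ x, dist x (σ x) = D := fun x ↦ by simpa using hσ x x
  have hσ1 : ∀ x z, dist z (σ x) = D - dist x z := fun x z ↦ by linarith [hσ x z]
  have hσ2 : ∀ x z, dist (σ x) z = D - dist x z := fun x z ↦ by rw [dist_comm, hσ1]
  have hσ3 : ∀ x z, dist (σ x) (σ z) = dist x z := fun x z ↦ by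
    rw [hσ1, hσ1, dist_comm x z]; ring
  have hσσ : ∀ x, σ (σ x) = x := fun x ↦ by
    have := hσ1 (σ x) x
    rw [dist_comm (σ x) x, hσd, sub_self, dist_eq_zero] at this
    exact this.symm
  obtain ⟨p⟩ := ‹Nonempty M›
  let U : Ultrafilter (Finset M) := Ultrafilter.of atTop
  have hU : (U : Filter (Finset M)) ≤ atTop := Ultrafilter.of_le atTop
  have hmem := eventually_mem_of_le_atTop hU
  have hpos : ∀ F : Finset M, p ∈ F → σ p ∈ F → 0 < dist (g F p) (g F (σ p)) := by
    intro F ha hb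
    refine dist_pos.2 fun h ↦ hD0.ne' ?_
    have := (hg F p ha _ hb p ha p ha).1 (by rw [h])
    rwa [dist_self, hσd] at this
  let φ : Finset M → M → E := fun F x ↦ (dist (g F p) (g F (σ p)))⁻¹ • (g F x - g F (σ x))
  have hφ1 : ∀ x, ∀ᶠ F in U, ‖φ F x‖ = 1 := by
    intro x
    filter_upwards [hmem x, hmem (σ x), hmem p, hmem (σ p)] with F hx hx' hp hp'
    have h1 := (hg F x hx _ hx' p hp _ hp').2 (by rw [hσd, hσd])
    simp only [φ]
    rw [norm_smul, ← dist_eq_norm, h1, norm_inv, Real.norm_eq_abs, abs_of_nonneg dist_nonneg,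
      inv_mul_cancel₀ (hpos F hp hp').ne']
  obtain ⟨k, hk⟩ := exists_tendsto_of_eventually_norm_le U fun x ↦ (hφ1 x).mono fun F h ↦ h.le
  refine ⟨k, preservesEqDist_of_tendsto hk fun x x' z z' hd ↦ ?_, fun x ↦ ?_, fun x ↦ ?_⟩
  · have hpolar : ∀ A A' B B' : E, dist (A - A') (B - B') ^ 2 =
        dist A A' ^ 2 + dist B B' ^ 2 + dist A B ^ 2 + dist A' B' ^ 2 - dist A B' ^ 2
          - dist A' B ^ 2 := by
      intro A A' B B'
      simp only [dist_eq_norm, ← real_inner_self_eq_norm_sq, inner_sub_left, inner_sub_right,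
        real_inner_comm A A', real_inner_comm A B, real_inner_comm A B', real_inner_comm A' B,
        real_inner_comm A' B', real_inner_comm B B']
      ring
    filter_upwards [hmem x, hmem (σ x), hmem x', hmem (σ x'), hmem z, hmem (σ z), hmem z',
      hmem (σ z')] with F x1 x2 x3 x4 z1 z2 z3 z4
    simp only [φ]
    rw [dist_smul₀, dist_smul₀]
    congr 1
    rw [← sq_eq_sq₀ dist_nonneg dist_nonneg, hpolar, hpolar,
      (hg F _ x1 _ x2 _ z1 _ z2).2 (by rw [hσd, hσd]),
      (hg F _ x3 _ x4 _ z3 _ z4).2 (by rw [hσd, hσd]),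
      (hg F _ x1 _ x3 _ z1 _ z3).2 hd,
      (hg F _ x2 _ x4 _ z2 _ z4).2 (by rw [hσ3, hσ3, hd]),
      (hg F _ x1 _ x4 _ z1 _ z4).2 (by rw [hσ1, hσ1, dist_comm x' x, dist_comm z' z, hd]),
      (hg F _ x2 _ x3 _ z2 _ z3).2 (by rw [hσ2, hσ2, hd])]
  · exact tendsto_nhds_unique (hk x).norm
      (tendsto_const_nhds.congr' ((hφ1 x).mono fun F h ↦ h.symm))
  · refine tendsto_nhds_unique (hk (σ x)) ((hk x).neg.congr fun F ↦ ?_)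
    simp only [φ]
    rw [hσσ, ← smul_neg, neg_sub]

/-- The case of dimension at least two. -/
theorem exists_isWeakLooseEmbedding_of_two_le {n : ℕ} (hn : 2 ≤ n) [CompactSpace M]
    [PreconnectedSpace M] [Nontrivial M] [ChartedSpace (EuclideanSpace ℝ (Fin n)) M]
    (hM : IsGeodesicSpace M)
    (hX : ∀ r : ℝ, 1 < r → ∃ η > 0, ∀ w v : M, dist w v < η → ∃ w' : M,
      dist w w' ≤ r ^ 2 * dist w v ∧ 2 * dist w v ≤ r ^ 2 * dist v w')
    {g : Finset M → M → E} (hg : ∀ F, IsLooseOn (g F) F) :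
    ∃ f : M → E, IsWeakLooseEmbedding f ∧ Continuous f := by
  obtain ⟨r₁, hr₁, hiso⟩ := exists_isosceles hn hM
  obtain ⟨f, hf, hfb, hfne⟩ := exists_preservesEqDist_limit hM hg hr₁ (hiso r₁ hr₁ le_rfl)
  have hfQ : ∀ x x' y y' : M, x ≠ x' → dist x x' ≤ r₁ → dist y y' ≤ 2 * dist x x' →
      dist (f y) (f y') ≤ 2 * dist (f x) (f x') := fun _ _ _ _ h1 h2 h3 ↦
    hf.dist_le_two_mul hiso h1 h2 h3
  have hfc := continuous_of_dist_le_two_mul hM hfb hr₁ hfQ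
  by_cases hinj : Function.Injective f
  · exact ⟨f, ⟨hinj, hf⟩, hfc⟩
  simp only [Function.Injective, not_forall] at hinj
  obtain ⟨p, q, hfpq, hpq⟩ := hinj
  have hD := hf.dist_le_of_eq hn hM hr₁ hfQ hfne hpq hfpq
  have hD0 : 0 < dist p q := dist_pos.2 hpq
  obtain ⟨σ, hσ⟩ := hf.exists_antipode hM hX hfc hD0 hD rfl hfpq fun x y hxy ↦ by
    by_cases h : x = y
    · exact Or.inl h
    · exact Or.inr (le_antisymm (hD x y) (hf.dist_le_of_eq hn hM hr₁ hfQ hfne h hxy p q))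
  obtain ⟨k, hk, hk1, hkσ⟩ := exists_odd_limit hD0 hσ hg
  have hne : ∀ x, k x ≠ k (σ x) := fun x h ↦ by
    rw [hkσ, eq_neg_iff_add_eq_zero, ← two_smul ℝ, smul_eq_zero_iff_right two_ne_zero] at h
    have := hk1 x
    rw [h, norm_zero] at this
    exact zero_ne_one this
  have hkQ : ∀ x x' y y' : M, x ≠ x' → dist x x' ≤ r₁ → dist y y' ≤ 2 * dist x x' →
      dist (k y) (k y') ≤ 2 * dist (k x) (k x') := fun _ _ _ _ h1 h2 h3 ↦
    hk.dist_le_two_mul hiso h1 h2 h3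
  refine ⟨k, ⟨fun x y hxy ↦ ?_, hk⟩, continuous_of_dist_le_two_mul hM ?_ hr₁ hkQ⟩
  · by_contra h
    have h1 := hk.dist_le_of_eq hn hM hr₁ hkQ ⟨p, σ p, hne p⟩ h hxy p q
    have h2 := hσ x y
    have h3 : dist y (σ x) = 0 := le_antisymm (by linarith) dist_nonneg
    rw [dist_eq_zero.1 h3] at hxy
    exact hne x hxy
  · refine (Metric.isBounded_closedBall (x := (0 : E)) (r := 1)).subset ?_
    rintro _ ⟨x, rfl⟩
    rw [mem_closedBall_zero_iff, hk1]

end UltraLimit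

/-! ### Geodesics in dimension one -/

section Circle

variable {M : Type*} [MetricSpace M]

/-- Invariance of domain for geodesics in a one-dimensional manifold. -/
theorem IsGeodesic.isOpen_image {γ : ℝ → M} {L : ℝ} (hγ : IsGeodesic γ L)
    (hchart : ∀ y : M, ∃ e : OpenPartialHomeomorph M ℝ, y ∈ e.source) :
    IsOpen (γ '' Ioo 0 L) := by
  rw [isOpen_iff_mem_nhds]
  rintro _ ⟨t, ht, rfl⟩
  obtain ⟨e, he⟩ := hchart (γ t)
  have hγc := hγ.continuousOn
  have hγt : ContinuousAt γ t := hγc.continuousAt (Icc_mem_nhds ht.1 ht.2)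
  have hev : ∀ᶠ s in 𝓝 t, s ∈ Ioo 0 L ∧ γ s ∈ e.source :=
    Filter.Eventually.and (isOpen_Ioo.mem_nhds ht) (hγt.eventually (e.open_source.mem_nhds he))
  obtain ⟨δ, hδ, hball⟩ := Metric.nhds_basis_closedBall.eventually_iff.1 hev
  rw [Real.closedBall_eq_Icc] at hball
  have hc : ContinuousOn (fun s ↦ e (γ s)) (Icc (t - δ) (t + δ)) :=
    e.continuousOn.comp (hγc.mono fun s hs ↦ Ioo_subset_Icc_self (hball hs).1)
      fun s hs ↦ (hball hs).2
  have hi : InjOn (fun s ↦ e (γ s)) (Icc (t - δ) (t + δ)) := by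
    intro s hs s' hs' h
    have h1 := e.injOn (hball hs).2 (hball hs').2 h
    have h2 := hγ s (Ioo_subset_Icc_self (hball hs).1) s' (Ioo_subset_Icc_self (hball hs').1)
    rw [h1, dist_self] at h2
    exact sub_eq_zero.1 (abs_eq_zero.1 h2.symm)
  have hlt : t - δ < t := by linarith
  have htl : t < t + δ := by linarith
  have hl : t - δ ∈ Icc (t - δ) (t + δ) := ⟨le_rfl, by linarith⟩
  have hr : t + δ ∈ Icc (t - δ) (t + δ) := ⟨by linarith, le_rfl⟩
  have hm : t ∈ Icc (t - δ) (t + δ) := ⟨hlt.le, htl.le⟩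
  have himg : (fun s ↦ e (γ s)) '' Ioo (t - δ) (t + δ) ∈ 𝓝 (e (γ t)) := by
    rcases hc.strictMonoOn_of_injOn_Icc' (by linarith) hi with h | h
    · exact mem_of_superset (Ioo_mem_nhds (h hl hm hlt) (h hm hr htl))
        (intermediate_value_Ioo (by linarith) hc)
    · exact mem_of_superset (Ioo_mem_nhds (h hm hr htl) (h hl hm hlt))
        (intermediate_value_Ioo' (by linarith) hc)
  filter_upwards [e.open_source.mem_nhds he, e.continuousAt he himg]
  rintro z hz ⟨s, hs, hsz⟩
  have hs' := hball (Ioo_subset_Icc_self hs)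
  exact ⟨s, hs'.1, e.injOn hs'.2 hz hsz⟩

/-- A path from a point off a geodesic `γ` to a point of `γ` enters through an end point of `γ`. -/
theorem IsGeodesic.dist_eq_min {γ : ℝ → M} {L : ℝ} (hγ : IsGeodesic γ L) (hM : IsGeodesicSpace M)
    (hopen : IsOpen (γ '' Ioo 0 L)) {z : M} (hz : z ∉ γ '' Icc 0 L) {t : ℝ} (ht : t ∈ Ioo 0 L) :
    dist z (γ t) = min (dist z (γ 0) + t) (dist z (γ L) + (L - t)) := by
  have htc := Ioo_subset_Icc_self ht
  have hd0 := hγ.dist_zero htc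
  have hdL := hγ.dist_end htc
  refine le_antisymm (le_min ?_ ?_) ?_
  · linarith [dist_triangle z (γ 0) (γ t)]
  · have := dist_triangle z (γ L) (γ t)
    rw [dist_comm (γ L)] at this
    linarith
  obtain ⟨β, hβ0, hβ1, hβ⟩ := hM z (γ t)
  have hK : IsClosed (γ '' Icc 0 L) :=
    (isCompact_Icc.image_of_continuousOn hγ.continuousOn).isClosed
  obtain ⟨s, hs, hsβ⟩ : ∃ s ∈ Icc 0 (dist z (γ t)), β s = γ 0 ∨ β s = γ L := by
    by_contra! hcon
    have hpre : IsPreconnected (β '' Icc 0 (dist z (γ t))) :=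
      isPreconnected_Icc.image _ hβ.continuousOn
    have hsub := hpre.subset_left_of_subset_union hK.isOpen_compl hopen
      (disjoint_compl_left.mono_right (image_mono Ioo_subset_Icc_self)) (by
        rintro _ ⟨s, hs, rfl⟩
        by_cases h : β s ∈ γ '' Icc 0 L
        · right
          obtain ⟨u, hu, hus⟩ := h
          refine ⟨u, ⟨lt_of_le_of_ne hu.1 ?_, lt_of_le_of_ne hu.2 ?_⟩, hus⟩
          · rintro rfl
            exact (hcon s hs).1 hus.symm
          · rintro rfl
            exact (hcon s hs).2 hus.symm
        · exact Or.inl h)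
      ⟨z, hβ0 ▸ mem_image_of_mem β ⟨le_rfl, dist_nonneg⟩, hz⟩
    exact hsub (mem_image_of_mem β ⟨dist_nonneg, le_rfl⟩)
      (by rw [hβ1]; exact mem_image_of_mem γ htc)
  have h1 := hβ.dist_zero hs
  have h2 := hβ.dist_end hs
  rw [hβ0] at h1
  rw [hβ1] at h2
  rcases hsβ with h | h <;> rw [h] at h1 h2
  · refine (min_le_left _ _).trans ?_
    linarith
  · refine (min_le_right _ _).trans ?_
    rw [dist_comm] at h2
    linarith

/-- Two points at maximal distance `D` have all points between them. -/
theorem dist_add_dist_eq_of_isGeodesic {γ : ℝ → M} {D : ℝ} (hγ : IsGeodesic γ D)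
    (hD : ∀ p q : M, dist p q ≤ D) (hM : IsGeodesicSpace M) (hopen : IsOpen (γ '' Ioo 0 D))
    (hD0 : 0 < D) (z : M) : dist (γ 0) z + dist z (γ D) = D := by
  by_cases hz : z ∈ γ '' Icc 0 D
  · obtain ⟨t, ht, rfl⟩ := hz
    rw [hγ.dist_zero ht, hγ.dist_end ht]
    ring
  have h0 : 0 < dist (γ 0) z := dist_pos.2 fun h ↦ hz ⟨0, ⟨le_rfl, hD0.le⟩, h⟩
  have h1 : 0 < dist z (γ D) := dist_pos.2 fun h ↦ hz ⟨D, ⟨hD0.le, le_rfl⟩, h.symm⟩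
  have h2 := hD (γ 0) z
  have h3 := hD z (γ D)
  have h4 := dist_triangle (γ 0) z (γ D)
  rw [hγ.dist_zero ⟨hD0.le, le_rfl⟩] at h4
  -- the point of `γ` at which both ways round have the same length
  have ht : (dist z (γ D) + D - dist (γ 0) z) / 2 ∈ Ioo 0 D := ⟨by linarith, by linarith⟩
  have h5 := hγ.dist_eq_min hM hopen hz ht
  rw [dist_comm z (γ 0)] at h5
  have h6 := hD z (γ ((dist z (γ D) + D - dist (γ 0) z) / 2))
  rw [h5, min_le_iff] at h6
  rcases h6 with h6 | h6 <;> linarith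

/-- Geodesics in a one-dimensional manifold do not branch. -/
theorem IsGeodesic.eqOn_of_eq {γ β : ℝ → M} {L : ℝ} (hγ : IsGeodesic γ L) (hβ : IsGeodesic β L)
    (hopen : IsOpen (γ '' Ioo 0 L)) (h0 : γ 0 = β 0) (h1 : γ L = β L) {s : ℝ} (hs : s ∈ Ioo 0 L)
    (h : γ s = β s) : EqOn γ β (Icc 0 L) := by
  have key : ∀ u ∈ Icc 0 L, ∀ t ∈ Icc 0 L, γ u = β t → u = t := by
    intro u hu t ht hut
    rw [← hγ.dist_zero hu, hut, h0, hβ.dist_zero ht]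
  have hK : IsClosed (γ '' Icc 0 L) :=
    (isCompact_Icc.image_of_continuousOn hγ.continuousOn).isClosed
  have hβc := hβ.continuousOn.mono Ioo_subset_Icc_self
  have hsub := isPreconnected_Ioo.subset_left_of_subset_union
    (hβc.isOpen_inter_preimage isOpen_Ioo hopen)
    (hβc.isOpen_inter_preimage isOpen_Ioo hK.isOpen_compl)
    (by
      rw [disjoint_left]
      rintro t ⟨-, ht⟩ ⟨-, ht'⟩
      exact ht' (image_mono Ioo_subset_Icc_self ht))
    (by
      intro t ht
      by_cases h : β t ∈ γ '' Icc 0 L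
      · obtain ⟨u, hu, hut⟩ := h
        have := key u hu t (Ioo_subset_Icc_self ht) hut
        subst this
        exact Or.inl ⟨ht, u, ht, hut⟩
      · exact Or.inr ⟨ht, h⟩)
    ⟨s, hs, hs, s, hs, h⟩
  intro t ht
  rcases eq_or_lt_of_le ht.1 with rfl | ht0
  · exact h0
  rcases eq_or_lt_of_le ht.2 with rfl | htL
  · exact h1
  obtain ⟨-, u, hu, hut⟩ := hsub ⟨ht0, htL⟩
  rwa [key u (Ioo_subset_Icc_self hu) t ht hut] at hut

/-- Two geodesics from the same point that leave it on the same side, in a chart, meet again. -/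
theorem IsGeodesic.eq_of_mem_uIcc {γ β : ℝ → M} {L s t : ℝ} (hγ : IsGeodesic γ L)
    (hβ : IsGeodesic β L) (h0 : γ 0 = β 0) {e : OpenPartialHomeomorph M ℝ} {δ : ℝ} (hδL : δ ≤ L)
    (he : Metric.ball (γ 0) δ ⊆ e.source) (hs : s ∈ Ico 0 δ) (ht : t ∈ Ico 0 δ)
    (h : e (γ s) ∈ uIcc (e (γ 0)) (e (β t))) : γ s = β s := by
  have hmem : ∀ u ∈ Ico 0 δ, β u ∈ e.source := fun u hu ↦ he <| by
    rw [Metric.mem_ball, dist_comm, h0, hβ.dist_zero ⟨hu.1, by linarith [hu.2]⟩]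
    exact hu.2
  have hsub : uIcc 0 t ⊆ Ico 0 δ := by
    rw [uIcc_of_le ht.1]
    exact fun u hu ↦ ⟨hu.1, hu.2.trans_lt ht.2⟩
  have hc : ContinuousOn (fun u ↦ e (β u)) (uIcc 0 t) :=
    e.continuousOn.comp (hβ.continuousOn.mono fun u hu ↦
      ⟨(hsub hu).1, (hsub hu).2.le.trans hδL⟩) fun u hu ↦ hmem u (hsub hu)
  rw [h0] at h
  obtain ⟨u, hu, hue⟩ := intermediate_value_uIcc hc h
  have hu' := hsub hu
  have hγs : γ s ∈ e.source := he <| by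
    rw [Metric.mem_ball, dist_comm, hγ.dist_zero ⟨hs.1, by linarith [hs.2]⟩]
    exact hs.2
  have h1 := e.injOn (hmem u hu') hγs hue
  rw [← h1]
  congr 1
  rw [← hβ.dist_zero ⟨hu'.1, by linarith [hu'.2]⟩, h1, ← h0,
    hγ.dist_zero ⟨hs.1, by linarith [hs.2]⟩]

/-- A compact one-dimensional geodesic space is a circle: it is the union of two geodesics that join
two points at maximal distance. -/
theorem exists_isGeodesic_union_eq_univ [CompactSpace M] [Nontrivial M] (hM : IsGeodesicSpace M)
    (hchart : ∀ y : M, ∃ e : OpenPartialHomeomorph M ℝ, y ∈ e.source) :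
    ∃ D > 0, ∃ γ β : ℝ → M, (∀ p q : M, dist p q ≤ D) ∧ IsGeodesic γ D ∧ IsGeodesic β D ∧
      γ 0 = β 0 ∧ γ D = β D ∧ γ '' Icc 0 D ∪ β '' Icc 0 D = univ ∧
      ∀ s ∈ Ioo 0 D, ∀ t ∈ Ioo 0 D, dist (γ s) (β t) = min (s + t) (2 * D - s - t) := by
  obtain ⟨⟨y, x⟩, -, hmax⟩ := isCompact_univ.exists_isMaxOn (univ_nonempty (α := M × M))
    continuous_dist.continuousOn
  have hD : ∀ p q : M, dist p q ≤ dist y x := fun p q ↦ hmax (mem_univ (p, q))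
  obtain ⟨p, q, hpq⟩ := exists_pair_ne M
  have hD0 : 0 < dist y x := (dist_pos.2 hpq).trans_le (hD p q)
  obtain ⟨α, hα0, hα1, hα⟩ := hM y x
  have hbetween : ∀ z, dist y z + dist z x = dist y x := fun z ↦ by
    have := dist_add_dist_eq_of_isGeodesic hα hD hM (hα.isOpen_image hchart) hD0 z
    rwa [hα0, hα1] at this
  generalize hDdef : dist y x = D at *
  have hthrough := fun z ↦ hM.exists_isGeodesic_through (hbetween z) hDdef
  obtain ⟨e, he⟩ := hchart y
  obtain ⟨δ, hδ, hδD, hball⟩ : ∃ δ > 0, δ ≤ D ∧ Metric.ball y δ ⊆ e.source := by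
    obtain ⟨δ, hδ, h⟩ := Metric.mem_nhds_iff.1 (e.open_source.mem_nhds he)
    exact ⟨min δ D, lt_min hδ hD0, min_le_right _ _,
      (Metric.ball_subset_ball (min_le_left _ _)).trans h⟩
  have himg : e '' Metric.ball y δ ∈ 𝓝 (e y) := by
    rw [← e.map_nhds_eq he]
    exact image_mem_map (Metric.ball_mem_nhds y hδ)
  obtain ⟨ρ, hρ, hρe⟩ := Metric.nhds_basis_closedBall.mem_iff.1 himg
  rw [Real.closedBall_eq_Icc] at hρe
  obtain ⟨z₁, hz₁, hez₁⟩ := hρe ⟨by linarith, le_rfl⟩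
  obtain ⟨z₂, hz₂, hez₂⟩ := hρe ⟨le_rfl, by linarith⟩
  obtain ⟨γ, hγ0, hγ1, hγ, hγz⟩ := hthrough z₁
  obtain ⟨β, hβ0, hβ1, hβ, hβz⟩ := hthrough z₂
  have hz₁' : dist y z₁ ∈ Ioo 0 δ := ⟨dist_pos.2 fun h ↦ by rw [← h] at hez₁; linarith,
    by rwa [dist_comm]⟩
  have hz₂' : dist y z₂ ∈ Ioo 0 δ := ⟨dist_pos.2 fun h ↦ by rw [← h] at hez₂; linarith,
    by rwa [dist_comm]⟩
  have hopen := hγ.isOpen_image hchart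
  -- a geodesic from `y` to `x` agrees with `γ` or `β`, according to the side on which it leaves `y`
  have hside : ∀ α' : ℝ → M, α' 0 = y → α' D = x → IsGeodesic α' D →
      EqOn α' γ (Icc 0 D) ∨ EqOn α' β (Icc 0 D) := by
    intro α' h0 h1 h
    have hs : δ / 2 ∈ Ioo 0 δ := ⟨by linarith, by linarith⟩
    have hmeet : ∀ η : ℝ → M, η 0 = y → η D = x → IsGeodesic η D → ∀ t ∈ Ioo 0 δ,
        (e (α' (δ / 2)) ∈ uIcc (e y) (e (η t)) ∨ e (η t) ∈ uIcc (e y) (e (α' (δ / 2)))) →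
        EqOn α' η (Icc 0 D) := by
      intro η hη0 hη1 hη t ht hor
      rcases hor with hor | hor
      · exact h.eqOn_of_eq hη (h.isOpen_image hchart) (h0.trans hη0.symm) (h1.trans hη1.symm)
          ⟨hs.1, by linarith⟩ (h.eq_of_mem_uIcc hη (h0.trans hη0.symm) hδD (by rwa [h0])
          (Ioo_subset_Ico_self hs) (Ioo_subset_Ico_self ht) (by rwa [h0]))
      · exact (hη.eqOn_of_eq h (hη.isOpen_image hchart) (hη0.trans h0.symm) (hη1.trans h1.symm)
          ⟨ht.1, ht.2.trans_le hδD⟩ (hη.eq_of_mem_uIcc h (hη0.trans h0.symm) hδD (by rwa [hη0])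
          (Ioo_subset_Ico_self ht) (Ioo_subset_Ico_self hs) (by rwa [hη0]))).symm
    have h1' := hmeet γ hγ0 hγ1 hγ _ hz₁'
    have h2' := hmeet β hβ0 hβ1 hβ _ hz₂'
    rw [hγz, hez₁] at h1'
    rw [hβz, hez₂] at h2'
    rcases le_total (e y) (e (α' (δ / 2))) with h3 | h3
    · refine Or.inl (h1' ?_)
      rw [uIcc_of_le h3, uIcc_of_le (by linarith)]
      rcases le_total (e (α' (δ / 2))) (e y + ρ) with h4 | h4
      · exact Or.inl ⟨h3, h4⟩
      · exact Or.inr ⟨by linarith, h4⟩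
    · refine Or.inr (h2' ?_)
      rw [uIcc_of_ge h3, uIcc_of_ge (by linarith)]
      rcases le_total (e (α' (δ / 2))) (e y - ρ) with h4 | h4
      · exact Or.inr ⟨h4, by linarith⟩
      · exact Or.inl ⟨h4, h3⟩
  have hne : ¬ EqOn γ β (Icc 0 D) := by
    intro heq
    have hsub : uIcc (dist y z₁) (dist y z₂) ⊆ Ioo 0 δ := ordConnected_Ioo.uIcc_subset hz₁' hz₂'
    have hmem : ∀ u ∈ uIcc (dist y z₁) (dist y z₂), γ u ∈ e.source := fun u hu ↦ hball <| by
      rw [Metric.mem_ball, dist_comm, ← hγ0,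
        hγ.dist_zero ⟨(hsub hu).1.le, by linarith [(hsub hu).2]⟩]
      exact (hsub hu).2
    have hc : ContinuousOn (fun u ↦ e (γ u)) (uIcc (dist y z₁) (dist y z₂)) :=
      e.continuousOn.comp (hγ.continuousOn.mono fun u hu ↦
        ⟨(hsub hu).1.le, by linarith [(hsub hu).2]⟩) hmem
    have h2 : γ (dist y z₂) = z₂ := by rw [heq ⟨hz₂'.1.le, hz₂'.2.le.trans hδD⟩, hβz]
    have hivt := intermediate_value_uIcc hc
    simp only [hγz, h2, hez₁, hez₂] at hivt
    obtain ⟨u, hu, hue⟩ := hivt (show e y ∈ _ by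
      rw [uIcc_of_ge (by linarith)]; exact ⟨by linarith, by linarith⟩)
    have h3 := e.injOn (hmem u hu) he hue
    have h4 := hγ.dist_zero ⟨(hsub hu).1.le, (hsub hu).2.le.trans hδD⟩
    rw [hγ0, h3, dist_self] at h4
    exact (hsub hu).1.ne h4
  refine ⟨D, hD0, γ, β, hD, hγ, hβ, hγ0.trans hβ0.symm, hγ1.trans hβ1.symm, ?_, ?_⟩
  · refine eq_univ_of_forall fun z ↦ ?_
    obtain ⟨η, hη0, hη1, hη, hηz⟩ := hthrough z
    have hzD : dist y z ∈ Icc 0 D := ⟨dist_nonneg, hD y z⟩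
    rcases hside η hη0 hη1 hη with h | h
    · exact Or.inl ⟨_, hzD, by rw [← h hzD, hηz]⟩
    · exact Or.inr ⟨_, hzD, by rw [← h hzD, hηz]⟩
  · intro s hs t ht
    have hsc := Ioo_subset_Icc_self hs
    have htc := Ioo_subset_Icc_self ht
    have hz : β t ∉ γ '' Icc 0 D := by
      rintro ⟨u, hu, hut⟩
      have : u = t := by rw [← hγ.dist_zero hu, hut, hγ0, ← hβ0, hβ.dist_zero htc]
      subst this
      exact hne (hγ.eqOn_of_eq hβ hopen (hγ0.trans hβ0.symm) (hγ1.trans hβ1.symm) ht hut)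
    rw [dist_comm, hγ.dist_eq_min hM hopen hz hs, hγ0, hγ1, ← hβ0, ← hβ1, dist_comm (β t) (β 0),
      hβ.dist_zero htc, hβ.dist_end htc]
    congr 1 <;> ring

end Circle

/-! ### Embedding the circle -/

theorem exists_openPartialHomeomorph_real {M : Type*} [TopologicalSpace M]
    [ChartedSpace (EuclideanSpace ℝ (Fin 1)) M] (y : M) :
    ∃ e : OpenPartialHomeomorph M ℝ, y ∈ e.source :=
  ⟨(chartAt (EuclideanSpace ℝ (Fin 1)) y).transHomeomorph
    ((EuclideanSpace.equiv (Fin 1) ℝ).toHomeomorph.trans (Homeomorph.funUnique (Fin 1) ℝ)),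
    mem_chart_source _ y⟩

section CircleEmbedding

variable {M : Type*} [MetricSpace M]

/-- A rhombus on a line is degenerate. -/
theorem eq_or_eq_of_abs_sub_eq {a b c d : ℝ} (h1 : |a - b| = |b - c|) (h2 : |a - b| = |c - d|)
    (h3 : |a - b| = |d - a|) : a = c ∨ b = d := by
  grind

/-- A square has no loose embedding in the line. -/
theorem two_le_of_square {N : ℕ} (hN : 0 < N) {a b c d : M} {r : ℝ}
    (hfin : ∀ F : Set M, F.Finite → LooselyEmbeddable F (EuclideanSpace ℝ (Fin N)))
    (hab : dist a b = r) (hbc : dist b c = r) (hcd : dist c d = r) (hda : dist d a = r)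
    (hac : a ≠ c) (hbd : b ≠ d) : 2 ≤ N := by
  by_contra! h
  obtain rfl : N = 1 := by omega
  obtain ⟨g, hg⟩ := hfin {a, b, c, d} (toFinite _)
  have hinj : ∀ u v, g u 0 = g v 0 → u = v := by
    intro u v huv
    have : g u = g v := by
      ext i
      rwa [Subsingleton.elim i 0]
    have h := (hg.dist_eq_iff u v u u).1 (by rw [this])
    rwa [dist_self, dist_eq_zero] at h
  have habs : ∀ u v, dist (g u) (g v) = |g u 0 - g v 0| := by
    intro u v
    rw [EuclideanSpace.dist_eq, Fin.sum_univ_one, Real.sqrt_sq dist_nonneg, Real.dist_eq]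
  let A : ({a, b, c, d} : Set M) := ⟨a, by simp⟩
  let B : ({a, b, c, d} : Set M) := ⟨b, by simp⟩
  let C : ({a, b, c, d} : Set M) := ⟨c, by simp⟩
  let D : ({a, b, c, d} : Set M) := ⟨d, by simp⟩
  have e1 := (hg.dist_eq_iff A B B C).2 (hab.trans hbc.symm)
  have e2 := (hg.dist_eq_iff A B C D).2 (hab.trans hcd.symm)
  have e3 := (hg.dist_eq_iff A B D A).2 (hab.trans hda.symm)
  rw [habs, habs] at e1 e2 e3
  rcases eq_or_eq_of_abs_sub_eq e1 e2 e3 with h | h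
  · exact hac (congrArg Subtype.val (hinj A C h))
  · exact hbd (congrArg Subtype.val (hinj B D h))

/-- A round circle is determined by the cosines of the angles between its points. -/
theorem exists_isWeakLooseEmbedding_of_cos {N : ℕ} (hN : 2 ≤ N) {D : ℝ} (hD0 : 0 < D)
    (hD : ∀ p q : M, dist p q ≤ D) (c s : M → ℝ)
    (h : ∀ z w, c z * c w + s z * s w = Real.cos (Real.pi / D * dist z w)) :
    ∃ f : M → EuclideanSpace ℝ (Fin N), IsWeakLooseEmbedding f ∧ Continuous f := by
  obtain ⟨k, rfl⟩ : ∃ k, N = k + 2 := ⟨N - 2, by omega⟩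
  let f : M → EuclideanSpace ℝ (Fin (k + 2)) := fun z ↦
    c z • EuclideanSpace.single 0 1 + s z • EuclideanSpace.single 1 1
  have hd : ∀ z w, dist (f z) (f w) = √(2 - 2 * Real.cos (Real.pi / D * dist z w)) := by
    intro z w
    have hz := h z z
    have hw := h w w
    rw [dist_self, mul_zero, Real.cos_zero] at hz hw
    rw [EuclideanSpace.dist_eq, ← h, Fin.sum_univ_succ, Fin.sum_univ_succ]
    congr 1
    simp [f, Real.dist_eq, sq_abs, Fin.ext_iff]
    nlinarith
  have hinj : Function.Injective f := by
    intro z w hzw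
    have h1 := hd z w
    rw [hzw, dist_self, eq_comm, Real.sqrt_eq_zero'] at h1
    have h2 : Real.cos (Real.pi / D * dist z w) = 1 :=
      le_antisymm (Real.cos_le_one _) (by linarith)
    have h3 : 0 ≤ Real.pi / D * dist z w := by positivity
    have h4 : Real.pi / D * dist z w ≤ Real.pi := by
      rw [div_mul_eq_mul_div, div_le_iff₀ hD0]
      exact mul_le_mul_of_nonneg_left (hD z w) Real.pi_pos.le
    have h5 := (Real.cos_eq_one_iff_of_lt_of_lt (by linarith [Real.pi_pos])
      (by linarith [Real.pi_pos])).1 h2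
    rcases mul_eq_zero.1 h5 with h6 | h6
    · exact absurd h6 (by positivity)
    · exact dist_eq_zero.1 h6
  refine ⟨f, ⟨hinj, fun x x' z z' hxz ↦ by rw [hd, hd, hxz]⟩,
    continuous_iff_continuousAt.2 fun z ↦ ?_⟩
  rw [ContinuousAt, tendsto_iff_dist_tendsto_zero]
  simp only [hd]
  have : Continuous fun w ↦ √(2 - 2 * Real.cos (Real.pi / D * dist w z)) := by fun_prop
  simpa using this.tendsto z

/-- The case of dimension one. -/
theorem exists_isWeakLooseEmbedding_of_dim_one [CompactSpace M] [Nontrivial M]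
    (hM : IsGeodesicSpace M) [ChartedSpace (EuclideanSpace ℝ (Fin 1)) M] {N : ℕ} (hN : 0 < N)
    (hfin : ∀ F : Set M, F.Finite → LooselyEmbeddable F (EuclideanSpace ℝ (Fin N))) :
    ∃ f : M → EuclideanSpace ℝ (Fin N), IsWeakLooseEmbedding f ∧ Continuous f := by
  classical
  obtain ⟨D, hD0, γ, β, hD, hγ, hβ, h0, h1, huniv, hdist⟩ :=
    exists_isGeodesic_union_eq_univ hM exists_openPartialHomeomorph_real
  have hmid : D / 2 ∈ Ioo 0 D := ⟨by linarith, by linarith⟩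
  have hmid' := Ioo_subset_Icc_self hmid
  have hN2 : 2 ≤ N := by
    refine two_le_of_square hN hfin (a := γ 0) (b := γ (D / 2)) (c := γ D) (d := β (D / 2))
      (r := D / 2) (hγ.dist_zero hmid') ?_ ?_ ?_ ?_ ?_
    · rw [hγ.dist_end hmid']; ring
    · rw [h1, dist_comm, hβ.dist_end hmid']; ring
    · rw [h0, dist_comm, hβ.dist_zero hmid']
    · rw [← dist_pos, hγ.dist_zero ⟨hD0.le, le_rfl⟩]
      exact hD0
    · rw [← dist_pos, hdist _ hmid _ hmid]
      exact lt_min (by linarith) (by linarith)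
  let θ : M → ℝ := fun z ↦ Real.pi / D * dist (γ 0) z
  refine exists_isWeakLooseEmbedding_of_cos hN2 hD0 hD (fun z ↦ Real.cos (θ z))
    (fun z ↦ if z ∈ γ '' Icc 0 D then Real.sin (θ z) else -Real.sin (θ z)) ?_
  have hθγ : ∀ t ∈ Icc 0 D, θ (γ t) = Real.pi / D * t := fun t ht ↦ by
    simp only [θ, hγ.dist_zero ht]
  have hθβ : ∀ t ∈ Icc 0 D, θ (β t) = Real.pi / D * t := fun t ht ↦ by
    simp only [θ, h0, hβ.dist_zero ht]
  have hoff : ∀ z, z ∉ γ '' Icc 0 D → ∃ t ∈ Ioo 0 D, β t = z := by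
    intro z hz
    rcases huniv.ge (mem_univ z) with h | ⟨t, ht, rfl⟩
    · exact absurd h hz
    refine ⟨t, ⟨lt_of_le_of_ne ht.1 ?_, lt_of_le_of_ne ht.2 ?_⟩, rfl⟩
    · rintro rfl
      exact hz ⟨0, ht, h0⟩
    · rintro rfl
      exact hz ⟨t, ht, h1⟩
  have hcos : ∀ s t : ℝ, Real.cos (Real.pi / D * |s - t|) =
      Real.cos (Real.pi / D * s) * Real.cos (Real.pi / D * t) +
        Real.sin (Real.pi / D * s) * Real.sin (Real.pi / D * t) := by
    intro s t
    rw [← Real.cos_sub, ← mul_sub, ← Real.cos_abs (Real.pi / D * (s - t)), abs_mul,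
      abs_of_pos (div_pos Real.pi_pos hD0)]
  have hmixed : ∀ s ∈ Icc 0 D, ∀ t ∈ Ioo 0 D, Real.cos (Real.pi / D * dist (γ s) (β t)) =
      Real.cos (Real.pi / D * s) * Real.cos (Real.pi / D * t) -
        Real.sin (Real.pi / D * s) * Real.sin (Real.pi / D * t) := by
    intro s hs t ht
    have htc := Ioo_subset_Icc_self ht
    rw [← Real.cos_add, ← mul_add]
    have hrefl : Real.cos (Real.pi / D * (2 * D - s - t)) = Real.cos (Real.pi / D * (s + t)) := by
      rw [show Real.pi / D * (2 * D - s - t) = 2 * Real.pi - Real.pi / D * (s + t) by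
        field_simp; ring, Real.cos_two_pi_sub]
    rcases eq_or_lt_of_le hs.1 with rfl | hs0
    · rw [h0, hβ.dist_zero htc, zero_add]
    rcases eq_or_lt_of_le hs.2 with rfl | hsD
    · rw [h1, dist_comm, hβ.dist_end htc, ← hrefl]
      congr 2
      ring
    rw [hdist s ⟨hs0, hsD⟩ t ht]
    rcases min_choice (s + t) (2 * D - s - t) with h | h <;> rw [h]
    exact hrefl
  intro z w
  by_cases hz : z ∈ γ '' Icc 0 D <;> by_cases hw : w ∈ γ '' Icc 0 D
  · simp only [hz, hw, if_true]
    obtain ⟨s, hs, rfl⟩ := hz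
    obtain ⟨t, ht, rfl⟩ := hw
    rw [hθγ s hs, hθγ t ht, hγ s hs t ht, hcos]
  · simp only [hz, hw, if_true, if_false]
    obtain ⟨s, hs, rfl⟩ := hz
    obtain ⟨t, ht, rfl⟩ := hoff w hw
    rw [hθγ s hs, hθβ t (Ioo_subset_Icc_self ht), hmixed s hs t ht]
    ring
  · simp only [hz, hw, if_true, if_false]
    obtain ⟨s, hs, rfl⟩ := hw
    obtain ⟨t, ht, rfl⟩ := hoff z hz
    rw [hθγ s hs, hθβ t (Ioo_subset_Icc_self ht), dist_comm, hmixed s hs t ht]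
    ring
  · simp only [hz, hw, if_false]
    obtain ⟨s, hs, rfl⟩ := hoff z hz
    obtain ⟨t, ht, rfl⟩ := hoff w hw
    have hsc := Ioo_subset_Icc_self hs
    have htc := Ioo_subset_Icc_self ht
    rw [hθβ s hsc, hθβ t htc, hβ s hsc t htc, hcos]
    ring

end CircleEmbedding

/-! ### Weak loose embeddings of Riemannian manifolds -/

/-- `M` is a compact connected smooth Riemannian manifold without boundary, with its geodesic
distance (the infimum of the lengths of `C^1` paths). -/
theorem mainTheorem2 {n : ℕ} {M : Type*} [MetricSpace M] [CompactSpace M] [ConnectedSpace M]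
    [ChartedSpace (EuclideanSpace ℝ (Fin n)) M] [IsManifold (𝓡 n) ∞ M]
    [RiemannianBundle (fun x : M ↦ TangentSpace (𝓡 n) x)]
    [IsContMDiffRiemannianBundle (𝓡 n) ∞ (EuclideanSpace ℝ (Fin n))
      (fun x : M ↦ TangentSpace (𝓡 n) x)]
    [IsRiemannianManifold (𝓡 n) M]
    (N : ℕ) (hN : 0 < N)
    (hfin : ∀ F : Set M, F.Finite → LooselyEmbeddable F (EuclideanSpace ℝ (Fin N))) :
    ∃ f : M → EuclideanSpace ℝ (Fin N), IsWeakLooseEmbedding f ∧ Continuous f := by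
  rcases subsingleton_or_nontrivial M with hs | hnt
  · exact ⟨fun _ ↦ 0, ⟨Function.injective_of_subsingleton _, fun _ _ _ _ _ ↦ rfl⟩, continuous_const⟩
  have hM := isGeodesicSpace_of_isRiemannianManifold n M
  rcases lt_trichotomy n 1 with hn | rfl | hn
  · -- a manifold of dimension `0` is discrete
    obtain rfl : n = 0 := by omega
    have := ChartedSpace.discreteTopology (EuclideanSpace ℝ (Fin 0)) M
    exact absurd (PreconnectedSpace.trivial_of_discrete (X := M)) (not_subsingleton M)
  · exact exists_isWeakLooseEmbedding_of_dim_one hM hN hfin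
  · choose g hg using exists_isLooseOn hfin
    exact exists_isWeakLooseEmbedding_of_two_le hn hM
      (fun r hr ↦ exists_almost_reflection n M hr) hg
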